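/- Let $d \ge 3$. For $\omega \in \mathbb{R}^{\mathbb{Z}^d}$ let $H_\omega = \Delta + \sum_{j \in \mathbb{Z}^d} \omega_j P_j$ on $\ell^2(\mathbb{Z}^d)$, where $(\Delta\psi)(x) = \sum_{|y-x|_1 = 1} \psi(y)$, $P_j$ is the orthogonal projection onto $\delta_j$, and the domain is $\{\psi \in \ell^2(\mathbb{Z}^d) : \Delta \psi + \omega\psi \in \ell^2(\mathbb{Z}^d)\}$. For $\lambda > 0$ (the Lloyd model of width $\lambda$) let the $\omega_j$ be independent with common law $d\nu_\lambda(x) = \frac{1}{\pi} \frac{\lambda}{x^2 + \lambda^2}\,dx$; for $\lambda = 0$ let $\nu_0$ be the Dirac mass at $0$, so that $H_\omega = \Delta$ almost surely. The density of states measure $n_\lambda$ is the Borel probability measure on $\mathbb{R}$ with $\int f\,dn_\lambda = \mathbb{E}\,\langle \delta_0, f(H_\omega)\delta_0\rangle$ for all real $f \in C_0(\mathbb{R})$, and the density of states function $\rho_\lambda$ is its density with respect to Lebesgue measure. **Theorem.** Every $H_\omega$ is self-adjoint; for every $\lambda \ge 0$ the measure $n_\lambda$ exists, is unique, and is absolutely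 continuous, so that $\rho_\lambda$ exists. Moreover: 1. $\|\rho_\lambda - \rho_0\|_\infty \to 0$ as $\lambda \to 0^+$, where $\|\cdot\|_\infty$ is the norm of $L^\infty(\mathbb{R})$. 2. For all $\lambda > 0$, $$\|\rho_\lambda - \rho_0\|_\infty \le D_L\, \lambda^{\frac{d-2}{d+2}}, \qquad D_L = D_L(d) = \frac{e}{2\pi} + \frac{2^{2 - d/2}}{\pi (d-2)}.$$ 3. There is $\lambda_1 = \lambda_1(d) > 0$ such that for all $0 < \lambda \le \lambda_1$, $$\|\rho_\lambda - \rho_0\|_\infty \le \frac{1}{(d-2)\, 2^{d - 9/2}\, \pi^{(d+1)/2}}\; \lambda^{\frac{d-2}{d+2}}.$$ -/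

import Mathlib

open MeasureTheory ProbabilityTheory Filter Topology
open scoped NNReal ENNReal ZeroAtInfty InnerProductSpace

noncomputable section

/-- The lattice `ℤ^d`. -/
abbrev LatticeSite (d : ℕ) : Type := Fin d → ℤ

/-- The Hilbert space `ℓ²(ℤ^d)` of square-summable complex functions on the lattice. -/
abbrev LatticeL2 (d : ℕ) : Type := lp (fun _ : LatticeSite d => ℂ) 2

/-- The formal Anderson Hamiltonian `Δ + ∑_j ω_j P_j`, where `P_j` is the rank-one projection onto
the site `j` and `Δ` is the finite-difference Laplacian, `(Δ ψ)(x) = ∑_{|y - x|₁ = 1} ψ(y)`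
(whose spectrum is `[-2d, 2d]`), acting on an arbitrary function on the lattice. -/
def andersonFormal {d : ℕ} (ω : LatticeSite d → ℝ) (ψ : LatticeSite d → ℂ) (x : LatticeSite d) : ℂ :=
  (∑ i : Fin d, (ψ (x + Pi.single i 1) + ψ (x - Pi.single i 1))) + (ω x : ℂ) * ψ x

theorem andersonFormal_add {d : ℕ} (ω : LatticeSite d → ℝ) (φ ψ : LatticeSite d → ℂ) :
    andersonFormal ω (φ + ψ) = andersonFormal ω φ + andersonFormal ω ψ := by
  funext x
  simp only [andersonFormal, Pi.add_apply, Finset.sum_add_distrib]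
  ring

theorem andersonFormal_smul {d : ℕ} (ω : LatticeSite d → ℝ) (c : ℂ) (ψ : LatticeSite d → ℂ) :
    andersonFormal ω (c • ψ) = c • andersonFormal ω ψ := by
  funext x
  simp only [andersonFormal, Pi.smul_apply, smul_eq_mul, mul_add, Finset.mul_sum]
  ring

/-- The domain of the (in general unbounded) Hamiltonian `H_ω`: all `ψ ∈ ℓ²(ℤ^d)` such that
`Δψ + ωψ ∈ ℓ²(ℤ^d)`; as `Δ` is bounded, this is the domain of multiplication by `ω`. -/
def andersonDomain {d : ℕ} (ω : LatticeSite d → ℝ) : Submodule ℂ (LatticeL2 d) where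
  carrier := {ψ | Memℓp (andersonFormal ω (ψ : LatticeSite d → ℂ)) 2}
  zero_mem' := by
    have h : andersonFormal ω ((0 : LatticeL2 d) : LatticeSite d → ℂ) = 0 := by
      funext x
      simp [andersonFormal]
    simp only [Set.mem_ofPred_eq, h]
    exact zero_memℓp
  add_mem' := by
    intro φ ψ hφ hψ
    simp only [Set.mem_ofPred_eq, lp.coeFn_add, andersonFormal_add] at *
    exact hφ.add hψ
  smul_mem' := by
    intro c ψ hψ
    simp only [Set.mem_ofPred_eq, lp.coeFn_smul, andersonFormal_smul] at *
    exact hψ.const_smul c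

/-- The Anderson Hamiltonian `H_ω = Δ + ∑_j ω_j P_j` as an unbounded operator on `ℓ²(ℤ^d)`. -/
def anderson {d : ℕ} (ω : LatticeSite d → ℝ) : LatticeL2 d →ₗ.[ℂ] LatticeL2 d where
  domain := andersonDomain ω
  toFun :=
    { toFun := fun ψ => ⟨andersonFormal ω (ψ : LatticeL2 d), ψ.2⟩
      map_add' := fun φ ψ => Subtype.ext (andersonFormal_add ω φ.1 ψ.1)
      map_smul' := fun c ψ => Subtype.ext (andersonFormal_smul ω c ψ.1) }

section FunctionalCalculus

variable {E : Type*} [NormedAddCommGroup E] [InnerProductSpace ℂ E]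

/-- `R` is the resolvent `(T - z)⁻¹` of the unbounded operator `T`: a bounded two-sided inverse of
`T - z`. Such an `R` is unique if it exists. -/
def IsResolventAt (T : E →ₗ.[ℂ] E) (z : ℂ) (R : E →L[ℂ] E) : Prop :=
  (∀ ψ : E, ∃ h : R ψ ∈ T.domain, T ⟨R ψ, h⟩ - z • R ψ = ψ) ∧
    ∀ φ : T.domain, R (T φ - z • (φ : E)) = φ

open Classical in
/-- The resolvent `(T - z)⁻¹`; it exists for all non-real `z` when `T` is self-adjoint. -/
def resolventAt (T : E →ₗ.[ℂ] E) (z : ℂ) : E →L[ℂ] E :=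
  if h : ∃ R : E →L[ℂ] E, IsResolventAt T z R then h.choose else 0

/-- The functional calculus `f(T)` of a self-adjoint, possibly unbounded, operator `T`, for
`f ∈ C₀(ℝ)`: with `R = (T - i)⁻¹`, a bounded normal operator, and the substitution `w = (x - i)⁻¹`,
that is `x = w⁻¹ + i`, one has `f(T) = g(R)`, where `g(w) = f(w⁻¹ + i)` for `w ≠ 0` and
`g(0) = 0`. Here `g(R)` is the continuous functional calculus of `R`. -/
def funCalc [CompleteSpace E] (T : E →ₗ.[ℂ] E) (f : C₀(ℝ, ℝ)) : E →L[ℂ] E :=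
  cfc (fun w : ℂ => if w = 0 then (0 : ℂ) else ((f (w⁻¹ + Complex.I).re : ℝ) : ℂ))
    (resolventAt T Complex.I)

end FunctionalCalculus

/-- The unit vector `δ₀ ∈ ℓ²(ℤ^d)`. -/
def deltaZero (d : ℕ) : LatticeL2 d := lp.single 2 (0 : LatticeSite d) (1 : ℂ)

/-- `Tr (P₀ f(H_ω) P₀) = ⟨δ₀, f(H_ω) δ₀⟩`; it is real since `f` is real-valued. -/
def siteTrace {d : ℕ} (f : C₀(ℝ, ℝ)) (ω : LatticeSite d → ℝ) : ℝ :=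
  (⟪deltaZero d, funCalc (anderson ω) f (deltaZero d)⟫_ℂ).re

/-- `n` is the density of states measure of the Anderson model on `ℤ^d` with single-site
distribution `ν`: the probability measure with `n(f) = 𝔼 [Tr (P₀ f(H_ω) P₀)]`, where the
potentials `ω_j`, `j ∈ ℤ^d`, are independent with common law `ν`. -/
def IsDOSMeasure (d : ℕ) (ν : Measure ℝ) [IsProbabilityMeasure ν] (n : Measure ℝ) : Prop :=
  IsProbabilityMeasure n ∧
    ∀ f : C₀(ℝ, ℝ),
      Integrable (siteTrace f) (Measure.infinitePi fun _ : LatticeSite d => ν) ∧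
        ∫ x, f x ∂n = ∫ ω, siteTrace f ω ∂(Measure.infinitePi fun _ : LatticeSite d => ν)

/-- `ρ` is (a version of) the density of states function: a Lebesgue density of the density of
states measure. -/
def IsDOSFunction (d : ℕ) (ν : Measure ℝ) [IsProbabilityMeasure ν] (ρ : ℝ → ℝ) : Prop :=
  Measurable ρ ∧ (∀ x, 0 ≤ ρ x) ∧
    IsDOSMeasure d ν (volume.withDensity fun x => ENNReal.ofReal (ρ x))

/-- The law of a single potential of the Lloyd model of width `lam`: the Cauchy distribution with
density `π⁻¹ lam / (x² + lam²)` for `lam > 0`, and the Dirac mass at `0`, that is the free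
Laplacian, for `lam = 0`. -/
abbrev lloydLaw (lam : ℝ≥0) : Measure ℝ := cauchyMeasure 0 lam

/-- The constant `e / (2π) + 2^(2 - d/2) / (π (d - 2))` in the bound for all `lam > 0`. -/
def lloydConst (d : ℕ) : ℝ :=
  Real.exp 1 / (2 * Real.pi) + 2 ^ (2 - (d : ℝ) / 2) / (Real.pi * ((d : ℝ) - 2))

/-- The constant `1 / ((d - 2) 2^(d - 9/2) π^((d + 1)/2))` in the bound for small `lam`. -/
def lloydConstWeak (d : ℕ) : ℝ :=
  1 / (((d : ℝ) - 2) * 2 ^ ((d : ℝ) - 9 / 2) * Real.pi ^ (((d : ℝ) + 1) / 2))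

end

noncomputable section

/-! ### Resolvents of self-adjoint operators -/

section SelfAdjointResolvent

variable {E : Type*} [NormedAddCommGroup E] [InnerProductSpace ℂ E]

/-! The Lloyd model is solvable because `y ↦ (y - w)⁻¹`, for `w` in the upper half plane, is
analytic and bounded in the lower half plane, so its Cauchy average of width `γ` is its value at
`-iγ`. A matrix element of the resolvent depends on a single `ω_j` through a Möbius function of this
type, hence averaging over `ω_j` replaces it by `-iγ`. Doing this for finitely many sites
(`IsDissipative.integral_inner_inverse_add_sum`) and removing the truncation by strong resolvent
convergence (`tendsto_inverse_truncated`) gives `integral_inner_resolventAt`: the averaged resolvent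
at `z` is the free one at `z + iγ`. The truncated operators with `-iγ` inserted are not
self-adjoint, which is why dissipative operators are used.

By the Fourier transform the free resolvent is an average over the torus, so the result is the
Stieltjes transform of `lloydDOS`, the law of the symbol plus an independent Cauchy variable.
Resolvent functions span a dense subspace (`circleResolvent_mem_submodule_eq_top`), so this
identifies the density of states measure, also for `γ = 0`.

The characteristic function of `lloydDOS` is `e^{-γ|t|} J₀(2t)^d`. Since `|J₀(s)| ≤ s^{-1/2}`
(`besselJ_sq_le`), it is integrable for `d ≥ 3` uniformly in `γ`, and Fourier inversion yields the
continuous density `lloydDensity`. Two such densities are compared under the integral sign: the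
difference from `γ = 0` is at most `π⁻¹ ∫₀^∞ (1 - e^{-γt}) |J₀(2t)|^d dt`
(`abs_lloydDensity_sub_le`). Cutting this integral at `T = γ^{-2/(d+2)}` gives the bound for all
widths, and with it the convergence. For small widths, `1 - e^{-x} ≤ x^a` with an exponent `a`
larger than `(d-2)/(d+2)` gives a faster rate, and the spare power of `γ` absorbs any positive
constant. -/

theorem IsResolventAt.unique {T : E →ₗ.[ℂ] E} {z : ℂ} {R S : E →L[ℂ] E}
    (hR : IsResolventAt T z R) (hS : IsResolventAt T z S) : R = S := by
  ext ψ
  obtain ⟨h, h'⟩ := hR.1 ψ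
  have := hS.2 ⟨R ψ, h⟩
  rw [h'] at this
  exact this.symm

theorem IsResolventAt.resolventAt_eq {T : E →ₗ.[ℂ] E} {z : ℂ} {R : E →L[ℂ] E}
    (hR : IsResolventAt T z R) : resolventAt T z = R := by
  have h : ∃ R : E →L[ℂ] E, IsResolventAt T z R := ⟨R, hR⟩
  rw [resolventAt, dif_pos h]
  exact h.choose_spec.unique hR

theorem IsResolventAt.resolvent_identity {T : E →ₗ.[ℂ] E} {z w : ℂ} {R S : E →L[ℂ] E}
    (hR : IsResolventAt T z R) (hS : IsResolventAt T w S) :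
    R - S = (z - w) • (R * S) := by
  ext ψ
  obtain ⟨h, h'⟩ := hS.1 ψ
  have h1 := hR.2 ⟨S ψ, h⟩
  have h2 : T ⟨S ψ, h⟩ - z • S ψ = ψ - (z - w) • S ψ := by
    rw [sub_smul, sub_eq_iff_eq_add.mp h']
    abel
  rw [h2, map_sub, map_smul] at h1
  change R ψ - S ψ = (z - w) • R (S ψ)
  rw [sub_eq_iff_eq_add] at h1 ⊢
  rw [h1, add_comm]

variable [CompleteSpace E]

theorem IsSelfAdjoint.inner_symm {T : E →ₗ.[ℂ] E} (hT : IsSelfAdjoint T) (φ ψ : T.domain) :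
    ⟪T φ, (ψ : E)⟫_ℂ = ⟪(φ : E), T ψ⟫_ℂ := by
  have h := LinearPMap.adjoint_isFormalAdjoint hT.dense_domain
  rw [LinearPMap.isSelfAdjoint_def.mp hT] at h
  exact h φ ψ

theorem IsSelfAdjoint.im_inner_apply_self {T : E →ₗ.[ℂ] E} (hT : IsSelfAdjoint T) (φ : T.domain) :
    (⟪(φ : E), T φ⟫_ℂ).im = 0 := by
  have h := inner_conj_symm (𝕜 := ℂ) (φ : E) (T φ)
  rw [hT.inner_symm] at h
  exact Complex.conj_eq_iff_im.mp h

/-- The form `⟪φ, Tφ⟫` is real, so `⟪φ, (T - z)φ⟫` has imaginary part `-(Im z)‖φ‖²`; conclude by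
Cauchy–Schwarz. -/
theorem IsSelfAdjoint.norm_le_norm_sub_smul {T : E →ₗ.[ℂ] E} (hT : IsSelfAdjoint T) (z : ℂ)
    (φ : T.domain) : |z.im| * ‖(φ : E)‖ ≤ ‖T φ - z • (φ : E)‖ := by
  rcases (norm_nonneg (φ : E)).eq_or_lt with h0 | h0
  · simp [← h0]
  have h1 : (⟪(φ : E), T φ - z • (φ : E)⟫_ℂ).im = -(z.im * ‖(φ : E)‖ ^ 2) := by
    rw [inner_sub_right, inner_smul_right, inner_self_eq_norm_sq_to_K, Complex.sub_im,
      hT.im_inner_apply_self, zero_sub, neg_inj]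
    simp [← Complex.ofReal_pow]
  have h2 := (Complex.abs_im_le_norm _).trans (norm_inner_le_norm (𝕜 := ℂ) (φ : E) (T φ - z • (φ : E)))
  rw [h1, abs_neg, abs_mul, abs_of_nonneg (sq_nonneg ‖(φ : E)‖)] at h2
  nlinarith

/-- The lower bound for `T - z` makes it injective with bounded inverse, and its range is closed
because the graph of `T` is. A vector orthogonal to the range is an eigenvector of the adjoint, that
is of `T`, for the eigenvalue `conj z`; the lower bound at `conj z` makes it zero. -/
theorem IsSelfAdjoint.exists_isResolventAt {T : E →ₗ.[ℂ] E} (hT : IsSelfAdjoint T) {z : ℂ}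
    (hz : z.im ≠ 0) : ∃ R : E →L[ℂ] E, IsResolventAt T z R := by
  set L : T.domain →ₗ[ℂ] E := T.toFun - z • T.domain.subtype with hL
  have hLa (φ : T.domain) : L φ = T φ - z • (φ : E) := rfl
  have hz' : 0 < |z.im| := abs_pos.mpr hz
  have hb (φ : T.domain) : ‖φ‖ ≤ |z.im|⁻¹ * ‖L φ‖ := by
    rw [hLa, inv_mul_eq_div, le_div_iff₀ hz', mul_comm]
    exact hT.norm_le_norm_sub_smul z φ
  have hinj : Function.Injective L := by
    refine (injective_iff_map_eq_zero L).mpr fun φ h => ?_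
    have := hb φ
    rw [h, norm_zero, mul_zero] at this
    exact norm_le_zero_iff.mp this
  have hcl : IsClosed (LinearMap.range L : Set E) := by
    refine isClosed_of_closure_subset fun η hη => ?_
    obtain ⟨y, hy, hyη⟩ := mem_closure_iff_seq_limit.mp hη
    choose φ hφ using hy
    have hc : CauchySeq fun n => ((φ n : T.domain) : E) := by
      have hc' := hyη.cauchySeq
      rw [Metric.cauchySeq_iff'] at hc' ⊢
      intro ε hε
      obtain ⟨N, hN⟩ := hc' (ε * |z.im|) (by positivity)
      refine ⟨N, fun n hn => ?_⟩
      have h1 := hN n hn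
      have h2 := hb (φ n - φ N)
      rw [map_sub, hφ, hφ, ← dist_eq_norm (y n)] at h2
      have h3 : dist ((φ n : T.domain) : E) (φ N) = ‖φ n - φ N‖ := by
        rw [dist_eq_norm]; rfl
      rw [h3]
      refine h2.trans_lt ?_
      rw [inv_mul_eq_div, div_lt_iff₀ hz']
      exact h1
    obtain ⟨φ₀, hφ₀⟩ := cauchySeq_tendsto_of_complete hc
    have hmem : (φ₀, η + z • φ₀) ∈ T.graph := by
      have hclosed : IsClosed (T.graph : Set (E × E)) := hT.isClosed
      refine hclosed.mem_of_tendsto (b := atTop)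
        (f := fun n => (((φ n : T.domain) : E), T (φ n))) ?_
        (Eventually.of_forall fun n => T.mem_graph (φ n))
      refine hφ₀.prodMk_nhds ?_
      have : (fun n => T (φ n)) = fun n => y n + z • ((φ n : T.domain) : E) := by
        funext n
        rw [← hφ n, hLa, sub_add_cancel]
      rw [this]
      exact hyη.add (hφ₀.const_smul z)
    obtain ⟨φ', h1, h2⟩ := (LinearPMap.mem_graph_iff T).mp hmem
    refine ⟨φ', ?_⟩
    rw [hLa, h2, h1]
    simp
  have hdense : (LinearMap.range L)ᗮ = ⊥ := by
    rw [Submodule.eq_bot_iff]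
    intro φ hφ
    have h1 (ψ : T.domain) : ⟪(starRingEnd ℂ z) • φ, (ψ : E)⟫_ℂ = ⟪φ, T ψ⟫_ℂ := by
      have h := (Submodule.mem_orthogonal' _ φ).mp hφ (L ψ) ⟨ψ, rfl⟩
      rw [hLa, inner_sub_right, inner_smul_right, sub_eq_zero] at h
      rw [h, inner_smul_left, Complex.conj_conj]
    have h2 : φ ∈ (T.adjoint).domain := LinearPMap.mem_adjoint_domain_of_exists φ ⟨_, h1⟩
    have h3 : T.adjoint ⟨φ, h2⟩ = (starRingEnd ℂ z) • φ :=
      LinearPMap.adjoint_apply_eq hT.dense_domain ⟨φ, h2⟩ h1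
    have h4 : (φ, (starRingEnd ℂ z) • φ) ∈ T.graph := by
      have h5 : (φ, (starRingEnd ℂ z) • φ) ∈ (T.adjoint).graph :=
        (LinearPMap.mem_graph_iff _).mpr ⟨⟨φ, h2⟩, rfl, h3⟩
      rwa [LinearPMap.isSelfAdjoint_def.mp hT] at h5
    obtain ⟨φ', h6, h7⟩ := (LinearPMap.mem_graph_iff T).mp h4
    have h8 := hT.norm_le_norm_sub_smul (starRingEnd ℂ z) φ'
    simp only at h6 h7
    rw [h7, h6, sub_self, norm_zero, Complex.conj_im, abs_neg] at h8
    have : ‖φ‖ ≤ 0 := by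
      by_contra! h
      exact absurd h8 (not_le.mpr (by positivity))
    exact norm_le_zero_iff.mp this
  have hsurj : Function.Surjective L := by
    rw [← LinearMap.range_eq_top, ← hcl.submodule_topologicalClosure_eq,
      Submodule.topologicalClosure_eq_top_iff, hdense]
  let e := LinearEquiv.ofBijective L ⟨hinj, hsurj⟩
  have he (ψ : E) : L (e.symm ψ) = ψ := e.apply_symm_apply ψ
  refine ⟨(T.domain.subtype ∘ₗ (e.symm : E →ₗ[ℂ] T.domain)).mkContinuous |z.im|⁻¹ fun ψ => ?_, ?_, ?_⟩
  · have := hb (e.symm ψ)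
    rwa [he] at this
  · intro ψ
    exact ⟨(e.symm ψ).2, he ψ⟩
  · intro φ
    have : e.symm (L φ) = φ := e.symm_apply_apply φ
    exact congrArg Subtype.val this

theorem IsSelfAdjoint.isResolventAt_resolventAt {T : E →ₗ.[ℂ] E} (hT : IsSelfAdjoint T) {z : ℂ}
    (hz : z.im ≠ 0) : IsResolventAt T z (resolventAt T z) := by
  obtain ⟨R, hR⟩ := hT.exists_isResolventAt hz
  rwa [hR.resolventAt_eq]

theorem IsSelfAdjoint.adjoint_resolventAt {T : E →ₗ.[ℂ] E} (hT : IsSelfAdjoint T) {z : ℂ}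
    (hz : z.im ≠ 0) :
    ContinuousLinearMap.adjoint (resolventAt T z) = resolventAt T (starRingEnd ℂ z) := by
  have hz' : (starRingEnd ℂ z).im ≠ 0 := by simpa using hz
  symm
  rw [ContinuousLinearMap.eq_adjoint_iff]
  intro x y
  obtain ⟨h, h'⟩ := (hT.isResolventAt_resolventAt hz).1 y
  obtain ⟨k, k'⟩ := (hT.isResolventAt_resolventAt hz').1 x
  set R := resolventAt T z
  set S := resolventAt T (starRingEnd ℂ z)
  conv_lhs => rw [← h']
  conv_rhs => rw [← k']
  rw [inner_sub_left, inner_sub_right, inner_smul_left, inner_smul_right, Complex.conj_conj]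
  have := hT.inner_symm ⟨S x, k⟩ ⟨R y, h⟩
  simp only at this
  rw [this]

end SelfAdjointResolvent

/-! ### The lattice Laplacian -/

section Lattice

variable {d : ℕ}

theorem Memℓp.comp_equiv {ψ : LatticeSite d → ℂ} (h : Memℓp ψ 2) (e : LatticeSite d ≃ LatticeSite d) :
    Memℓp (fun x => ψ (e x)) 2 := by
  rw [memℓp_gen_iff (by norm_num)] at h ⊢
  exact h.comp_injective e.injective

/-- The translation `ψ ↦ ψ (· + a)` of `ℓ²(ℤ^d)`. -/
def latticeShift (a : LatticeSite d) : LatticeL2 d →L[ℂ] LatticeL2 d :=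
  LinearMap.mkContinuous
    { toFun := fun ψ => ⟨fun x => ψ (x + a), (lp.memℓp ψ).comp_equiv (Equiv.addRight a)⟩
      map_add' := fun _ _ => rfl
      map_smul' := fun _ _ => rfl } 1 fun ψ => by
    rw [one_mul]
    refine lp.norm_le_of_tsum_le (by norm_num) (norm_nonneg _) ?_
    rw [lp.norm_rpow_eq_tsum (by norm_num)]
    exact (Equiv.tsum_eq (Equiv.addRight a) fun x => ‖ψ x‖ ^ (2 : ℝ≥0∞).toReal).le

@[simp]
theorem latticeShift_apply (a : LatticeSite d) (ψ : LatticeL2 d) (x : LatticeSite d) :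
    latticeShift a ψ x = ψ (x + a) := rfl

theorem inner_latticeShift (a : LatticeSite d) (φ ψ : LatticeL2 d) :
    ⟪latticeShift a φ, ψ⟫_ℂ = ⟪φ, latticeShift (-a) ψ⟫_ℂ := by
  rw [lp.inner_eq_tsum, lp.inner_eq_tsum, ← Equiv.tsum_eq (Equiv.addRight (-a))]
  simp

/-- The finite-difference Laplacian as a bounded operator on `ℓ²(ℤ^d)`. -/
def latticeLaplacian (d : ℕ) : LatticeL2 d →L[ℂ] LatticeL2 d :=
  ∑ i : Fin d, (latticeShift (Pi.single i 1) + latticeShift (-Pi.single i 1))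

theorem latticeLaplacian_apply (ψ : LatticeL2 d) (x : LatticeSite d) :
    latticeLaplacian d ψ x =
      ∑ i : Fin d, (ψ (x + Pi.single i 1) + ψ (x - Pi.single i 1)) := by
  simp only [latticeLaplacian, sum_apply, lp.coeFn_sum, Finset.sum_apply]
  refine Finset.sum_congr rfl fun i _ => ?_
  rw [add_apply, lp.coeFn_add, Pi.add_apply, latticeShift_apply, latticeShift_apply,
    sub_eq_add_neg]

theorem inner_latticeLaplacian (φ ψ : LatticeL2 d) :
    ⟪latticeLaplacian d φ, ψ⟫_ℂ = ⟪φ, latticeLaplacian d ψ⟫_ℂ := by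
  simp only [latticeLaplacian, sum_apply, sum_inner, inner_sum]
  refine Finset.sum_congr rfl fun i _ => ?_
  rw [add_apply, add_apply, inner_add_left, inner_add_right, inner_latticeShift,
    inner_latticeShift, neg_neg, add_comm]

theorem im_inner_latticeLaplacian_self (ψ : LatticeL2 d) :
    (⟪ψ, latticeLaplacian d ψ⟫_ℂ).im = 0 := by
  have h := inner_conj_symm (𝕜 := ℂ) ψ (latticeLaplacian d ψ)
  rw [inner_latticeLaplacian] at h
  exact Complex.conj_eq_iff_im.mp h

theorem andersonFormal_eq (ω : LatticeSite d → ℝ) (ψ : LatticeL2 d) :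
    andersonFormal ω ψ = ⇑(latticeLaplacian d ψ) + fun x => (ω x : ℂ) * ψ x := by
  funext x
  rw [Pi.add_apply, latticeLaplacian_apply]
  rfl

theorem mem_andersonDomain {ω : LatticeSite d → ℝ} {ψ : LatticeL2 d} :
    ψ ∈ andersonDomain ω ↔ Memℓp (fun x => (ω x : ℂ) * ψ x) 2 := by
  change Memℓp (andersonFormal ω ψ) 2 ↔ _
  rw [andersonFormal_eq]
  refine ⟨fun h => ?_, fun h => (lp.memℓp _).add h⟩
  have := h.sub (lp.memℓp (latticeLaplacian d ψ))
  rwa [add_sub_cancel_left] at this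

theorem anderson_apply {ω : LatticeSite d → ℝ} (ψ : (anderson ω).domain) :
    anderson ω ψ = latticeLaplacian d (ψ : LatticeL2 d) +
      ⟨fun x => (ω x : ℂ) * (ψ : LatticeL2 d) x, mem_andersonDomain.mp ψ.2⟩ :=
  lp.ext (andersonFormal_eq ω ψ)

/-- The unit vector at the site `j`. -/
def siteVector (j : LatticeSite d) : LatticeL2 d := lp.single 2 j (1 : ℂ)

theorem inner_siteVector (j : LatticeSite d) (ψ : LatticeL2 d) : ⟪siteVector j, ψ⟫_ℂ = ψ j := by
  rw [siteVector, lp.inner_single_left]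
  simp

theorem siteVector_apply (j x : LatticeSite d) : siteVector j x = if x = j then 1 else 0 := by
  rw [siteVector, lp.single_apply, Pi.single_apply]

theorem norm_siteVector (j : LatticeSite d) : ‖siteVector j‖ = 1 := by
  rw [siteVector, lp.norm_single (by norm_num), norm_one]

theorem memℓp_mul_siteVector (v : LatticeSite d → ℂ) (j : LatticeSite d) :
    Memℓp (fun x => v x * siteVector j x) 2 := by
  have : (fun x => v x * siteVector j x) = ⇑(v j • siteVector j) := by
    funext x
    rw [lp.coeFn_smul, Pi.smul_apply, smul_eq_mul, siteVector_apply]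
    split_ifs with h <;> simp [h]
  rw [this]
  exact lp.memℓp _

theorem siteVector_mem_domain (ω : LatticeSite d → ℝ) (j : LatticeSite d) :
    siteVector j ∈ (anderson ω).domain :=
  mem_andersonDomain.mpr (memℓp_mul_siteVector _ j)

theorem dense_andersonDomain (ω : LatticeSite d → ℝ) :
    Dense ((anderson ω).domain : Set (LatticeL2 d)) := by
  rw [Submodule.dense_iff_topologicalClosure_eq_top, Submodule.topologicalClosure_eq_top_iff,
    Submodule.eq_bot_iff]
  intro φ hφ
  refine lp.ext (funext fun x => ?_)
  rw [← inner_siteVector, lp.coeFn_zero, Pi.zero_apply]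
  exact (Submodule.mem_orthogonal _ φ).mp hφ _ (siteVector_mem_domain ω x)

theorem isFormalAdjoint_anderson (ω : LatticeSite d → ℝ) :
    (anderson ω).IsFormalAdjoint (anderson ω) := by
  intro φ ψ
  rw [anderson_apply, anderson_apply, inner_add_left, inner_add_right, inner_latticeLaplacian]
  congr 1
  rw [lp.inner_eq_tsum, lp.inner_eq_tsum]
  refine tsum_congr fun x => ?_
  change ⟪(ω x : ℂ) * (φ : LatticeL2 d) x, (ψ : LatticeL2 d) x⟫_ℂ =
    ⟪(φ : LatticeL2 d) x, (ω x : ℂ) * (ψ : LatticeL2 d) x⟫_ℂ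
  simp only [RCLike.inner_apply, map_mul, Complex.conj_ofReal]
  ring

theorem isSelfAdjoint_anderson (ω : LatticeSite d → ℝ) : IsSelfAdjoint (anderson ω) := by
  rw [LinearPMap.isSelfAdjoint_def]
  have hd := dense_andersonDomain ω
  refine le_antisymm ?_ ((isFormalAdjoint_anderson ω).le_adjoint hd)
  -- Pairing with the unit vectors, which lie in the domain, shows that the adjoint acts by the
  -- formal expression. Its domain is therefore contained in the maximal domain, which is the chosen
  -- one.
  have key (φ : (anderson ω).adjoint.domain) :
      ⇑((anderson ω).adjoint φ) = andersonFormal ω (φ : LatticeL2 d) := by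
    funext x
    have h := LinearPMap.adjoint_isFormalAdjoint hd φ ⟨siteVector x, siteVector_mem_domain ω x⟩
    rw [← inner_conj_symm, inner_siteVector, ← inner_conj_symm (φ : LatticeL2 d)] at h
    rw [(starRingEnd ℂ).injective h, anderson_apply, inner_add_left, inner_latticeLaplacian,
      inner_siteVector, andersonFormal_eq, Pi.add_apply]
    congr 1
    have : (⟨fun y => (ω y : ℂ) * siteVector x y, memℓp_mul_siteVector _ x⟩ : LatticeL2 d) =
        (ω x : ℂ) • siteVector x := by
      refine lp.ext (funext fun y => ?_)
      rw [lp.coeFn_smul, Pi.smul_apply, smul_eq_mul]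
      change (ω y : ℂ) * siteVector x y = _
      rw [siteVector_apply]
      split_ifs with h <;> simp [h]
    rw [this, inner_smul_left, inner_siteVector, Complex.conj_ofReal]
  refine ⟨fun φ hφ => ?_, fun φ ψ h => ?_⟩
  · change Memℓp (andersonFormal ω φ) 2
    rw [← key ⟨φ, hφ⟩]
    exact lp.memℓp _
  · refine lp.ext ?_
    rw [key φ, h]
    rfl

end Lattice

/-! ### The Cauchy distribution -/

section Cauchy

theorem integrable_exp_neg_abs_add {c : ℝ} (hc : 0 < c) (x : ℝ) :
    Integrable fun t : ℝ => Complex.exp (-(c * |t|) + x * t * Complex.I) := by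
  have hpos : IntegrableOn (fun t : ℝ => Complex.exp (-(c * |t|) + x * t * Complex.I))
      (Set.Ioi 0) := by
    refine (integrableOn_exp_mul_complex_Ioi (a := -c + x * Complex.I) (by simpa) 0).congr_fun
      (fun t ht => ?_) measurableSet_Ioi
    rw [abs_of_pos (Set.mem_Ioi.mp ht)]
    ring_nf
  have hneg : IntegrableOn (fun t : ℝ => Complex.exp (-(c * |t|) + x * t * Complex.I))
      (Set.Iic 0) := by
    refine (integrableOn_exp_mul_complex_Iic (a := c + x * Complex.I) (by simpa) 0).congr_fun
      (fun t ht => ?_) measurableSet_Iic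
    dsimp only
    rw [abs_of_nonpos (Set.mem_Iic.mp ht)]
    push_cast
    ring_nf
  rw [← integrableOn_univ, ← Set.Iic_union_Ioi (a := (0 : ℝ))]
  exact hneg.union hpos

/-- Each half line is an exponential integral. Up to normalization the right side is the Cauchy
density, which gives both its characteristic function and its cosine representation. -/
theorem integral_exp_neg_abs_add {c : ℝ} (hc : 0 < c) (x : ℝ) :
    ∫ t : ℝ, Complex.exp (-(c * |t|) + x * t * Complex.I) = ((2 * c / (c ^ 2 + x ^ 2) : ℝ) : ℂ) := by
  have hi := integrable_exp_neg_abs_add hc x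
  rw [← intervalIntegral.integral_Iic_add_Ioi (b := 0) hi.integrableOn hi.integrableOn]
  have h1 : ∫ t in Set.Iic (0 : ℝ), Complex.exp (-(c * |t|) + x * t * Complex.I) =
      1 / (c + x * Complex.I) := by
    rw [← setIntegral_congr_fun measurableSet_Iic
      (f := fun t : ℝ => Complex.exp ((c + x * Complex.I) * t)) fun t ht => ?_,
      integral_exp_mul_complex_Iic (by simpa)]
    · simp
    · dsimp only
      rw [abs_of_nonpos (Set.mem_Iic.mp ht)]
      push_cast
      ring_nf
  have h2 : ∫ t in Set.Ioi (0 : ℝ), Complex.exp (-(c * |t|) + x * t * Complex.I) =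
      1 / (c - x * Complex.I) := by
    rw [← setIntegral_congr_fun measurableSet_Ioi
      (f := fun t : ℝ => Complex.exp ((-c + x * Complex.I) * t)) fun t ht => ?_,
      integral_exp_mul_complex_Ioi (by simpa)]
    · rw [Complex.ofReal_zero, mul_zero, Complex.exp_zero, ← neg_sub, neg_div, one_div, one_div,
        ← inv_neg]
      ring_nf
    · dsimp only
      rw [abs_of_pos (Set.mem_Ioi.mp ht)]
      ring_nf
  have h3 : (c + x * Complex.I : ℂ) ≠ 0 := fun h => hc.ne' (by simpa using congrArg Complex.re h)
  have h4 : (c - x * Complex.I : ℂ) ≠ 0 := fun h => hc.ne' (by simpa using congrArg Complex.re h)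
  have h5 : (c ^ 2 + x ^ 2 : ℂ) = (c + x * Complex.I) * (c - x * Complex.I) := by
    linear_combination (x ^ 2 : ℂ) * Complex.I_sq
  rw [h1, h2]
  push_cast
  rw [h5, div_add_div _ _ h3 h4]
  ring

theorem integral_cauchyMeasure {γ : ℝ≥0} (hγ : γ ≠ 0) (f : ℝ → ℂ) :
    ∫ x, f x ∂(cauchyMeasure 0 γ) = ∫ x, (cauchyPDFReal 0 γ x : ℂ) * f x := by
  rw [cauchyMeasure_of_scale_ne_zero 0 hγ,
    integral_withDensity_eq_integral_toReal_smul (measurable_cauchyPDF 0 γ)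
      (Eventually.of_forall fun x => ENNReal.ofReal_lt_top)]
  refine integral_congr_ae (Eventually.of_forall fun x => ?_)
  dsimp only
  rw [cauchyPDF_def, ENNReal.toReal_ofReal (cauchyPDF_pos 0 hγ x).le, Complex.real_smul]

open FourierTransform in
-- Fourier inversion replaces a contour integral: the Cauchy density is the Fourier transform of
-- `e^{-c|s|}`. The value `c = 2πγ` comes from the kernel `e^{-2πisξ}`.
theorem charFun_cauchyMeasure (γ : ℝ≥0) (t : ℝ) :
    charFun (cauchyMeasure 0 γ) t = Complex.exp (-(γ * |t|)) := by
  rcases eq_or_ne γ 0 with rfl | hγ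
  · simp
  have hγ' : (0 : ℝ) < γ := by positivity
  set c : ℝ := 2 * Real.pi * γ with hc
  have hc0 : 0 < c := by positivity
  set f : ℝ → ℂ := fun s => Complex.exp (-(c * |s|)) with hf
  have hF : 𝓕 f = fun ξ => (cauchyPDFReal 0 γ ξ : ℂ) := by
    funext ξ
    rw [Real.fourier_real_eq_integral_exp_smul]
    have := integral_exp_neg_abs_add hc0 (-2 * Real.pi * ξ)
    convert this using 1
    · refine integral_congr_ae (Eventually.of_forall fun s => ?_)
      dsimp only
      rw [hf, smul_eq_mul, ← Complex.exp_add]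
      push_cast
      ring_nf
    · congr 1
      rw [cauchyPDFReal_def, hc]
      have : (2 * Real.pi * γ) ^ 2 + (-2 * Real.pi * ξ) ^ 2 = 4 * Real.pi ^ 2 * (ξ ^ 2 + γ ^ 2) := by
        ring
      rw [this, sub_zero]
      have : ξ ^ 2 + (γ : ℝ) ^ 2 ≠ 0 := by positivity
      field_simp
      ring
  have hfi : Integrable f := by
    have := integrable_exp_neg_abs_add hc0 0
    simpa [hf] using this
  have hinv := congrFun (Continuous.fourierInv_fourier_eq (f := f) (by fun_prop) hfi
    (by rw [hF]; exact (integrable_cauchyPDFReal 0).ofReal)) (t / (2 * Real.pi))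
  rw [hF, Real.fourierInv_eq'] at hinv
  have hft : f (t / (2 * Real.pi)) = Complex.exp (-(γ * |t|)) := by
    rw [hf]
    dsimp only
    rw [abs_div, abs_of_pos (by positivity : 0 < 2 * Real.pi), hc]
    congr 2
    have : ((Real.pi : ℝ) : ℂ) ≠ 0 := by exact_mod_cast Real.pi_ne_zero
    push_cast
    field_simp
  rw [← hft, ← hinv, charFun_apply_real, integral_cauchyMeasure hγ]
  refine integral_congr_ae (Eventually.of_forall fun x => ?_)
  dsimp only
  rw [smul_eq_mul, mul_comm]
  congr 2
  have : ((Real.pi : ℝ) : ℂ) ≠ 0 := by exact_mod_cast Real.pi_ne_zero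
  simp only [RCLike.inner_apply, conj_trivial]
  push_cast
  field_simp

theorem integrable_inv_sub_of_im_pos {μ : Measure ℝ} [IsFiniteMeasure μ] {w : ℂ} (hw : 0 < w.im) :
    Integrable (fun y : ℝ => ((y : ℂ) - w)⁻¹) μ := by
  refine Integrable.of_bound (C := w.im⁻¹) (by fun_prop) (Eventually.of_forall fun y => ?_)
  rw [norm_inv]
  refine inv_anti₀ hw ?_
  have := Complex.abs_im_le_norm ((y : ℂ) - w)
  rwa [Complex.sub_im, Complex.ofReal_im, zero_sub, abs_neg, abs_of_pos hw] at this

/-- The Cauchy average of `y ↦ (y - w)⁻¹`, which is analytic in the lower half plane, is its value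
at `-iγ`. -/
theorem integral_inv_sub_cauchyMeasure (γ : ℝ≥0) {w : ℂ} (hw : 0 < w.im) :
    ∫ y, ((y : ℂ) - w)⁻¹ ∂(cauchyMeasure 0 γ) = (-(γ * Complex.I) - w)⁻¹ := by
  -- A Laplace integral turns `(a - w)⁻¹` into exponentials. It is used twice, for real `a = y` and
  -- for `a = -iγ`; in between, the characteristic function supplies the factor `e^{-γt}`.
  have key (a : ℂ) (ha : a.im < w.im) :
      ∫ t in Set.Ioi (0 : ℝ), Complex.exp (Complex.I * (w - a) * t) = -Complex.I * (a - w)⁻¹ := by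
    have hne : a - w ≠ 0 := fun h => by
      rw [sub_eq_zero.mp h] at ha
      exact lt_irrefl _ ha
    have hne' : w - a ≠ 0 := by rwa [← neg_sub, neg_ne_zero]
    rw [integral_exp_mul_complex_Ioi (by simpa using ha), ← neg_sub w a]
    simp only [Complex.ofReal_zero, mul_zero, Complex.exp_zero]
    have := Complex.I_ne_zero
    field_simp
    simp
  have h1 (y : ℝ) : ((y : ℂ) - w)⁻¹ =
      Complex.I * ∫ t in Set.Ioi (0 : ℝ), Complex.exp (Complex.I * (w - y) * t) := by
    rw [key y (by simpa using hw), ← mul_assoc]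
    simp
  simp_rw [h1]
  rw [integral_const_mul, integral_integral_swap]
  · have h2 : ∀ t ∈ Set.Ioi (0 : ℝ),
        ∫ y, Complex.exp (Complex.I * (w - y) * t) ∂(cauchyMeasure 0 γ) =
          Complex.exp (Complex.I * (w - (-(γ * Complex.I))) * t) := by
      intro t ht
      have h3 (y : ℝ) : Complex.exp (Complex.I * (w - y) * t) =
          Complex.exp (Complex.I * w * t) * Complex.exp ((-t : ℝ) * y * Complex.I) := by
        rw [← Complex.exp_add]
        push_cast
        ring_nf
      simp_rw [h3]
      rw [integral_const_mul, ← charFun_apply_real, charFun_cauchyMeasure, ← Complex.exp_add,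
        abs_neg, abs_of_pos (Set.mem_Ioi.mp ht)]
      congr 1
      linear_combination (-(γ : ℂ) * t) * Complex.I_sq
    rw [setIntegral_congr_fun measurableSet_Ioi h2, key _ (by
      have : (0 : ℝ) ≤ γ := γ.2
      simp; linarith), ← mul_assoc]
    simp
  · refine Integrable.mono' (g := fun p : ℝ × ℝ => 1 * Real.exp (-w.im * p.2)) ?_
      (by fun_prop) (Eventually.of_forall fun p => ?_)
    · exact (integrable_const (1 : ℝ)).mul_prod (integrableOn_exp_mul_Ioi (neg_neg_of_pos hw) 0)
    · rw [Function.uncurry, Complex.norm_exp, one_mul]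
      refine Real.exp_le_exp.mpr (le_of_eq ?_)
      simp

end Cauchy

/-! ### Dissipative operators and averages of their inverses -/

section Dissipative

variable {E : Type*} [NormedAddCommGroup E] [InnerProductSpace ℂ E]

/-- The imaginary part of the quadratic form of `T` is at most `-ε`. -/
def IsDissipative (T : E →L[ℂ] E) (ε : ℝ) : Prop :=
  ∀ ψ : E, (⟪ψ, T ψ⟫_ℂ).im ≤ -(ε * ‖ψ‖ ^ 2)

theorem IsDissipative.mul_norm_sq_le {T : E →L[ℂ] E} {ε : ℝ} (hT : IsDissipative T ε) (ψ : E) :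
    ε * ‖ψ‖ ^ 2 ≤ ‖⟪ψ, T ψ⟫_ℂ‖ := by
  have h1 := hT ψ
  have h2 := neg_abs_le (⟪ψ, T ψ⟫_ℂ).im
  have h3 := Complex.abs_im_le_norm ⟪ψ, T ψ⟫_ℂ
  linarith

theorem IsDissipative.mul_norm_le {T : E →L[ℂ] E} {ε : ℝ} (hT : IsDissipative T ε) (ψ : E) :
    ε * ‖ψ‖ ≤ ‖T ψ‖ := by
  rcases (norm_nonneg ψ).eq_or_lt with h0 | h0
  · simp [← h0]
  have := (hT.mul_norm_sq_le ψ).trans (norm_inner_le_norm _ _)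
  nlinarith

theorem IsDissipative.add_smul_rankOne {T : E →L[ℂ] E} {ε : ℝ} (hT : IsDissipative T ε) {c : ℂ}
    (hc : c.im ≤ 0) (e : E) : IsDissipative (T + c • InnerProductSpace.rankOne ℂ e e) ε := by
  intro ψ
  rw [add_apply, smul_apply, InnerProductSpace.rankOne_apply,
    inner_add_right, inner_smul_right, inner_smul_right, ← inner_conj_symm ψ e, Complex.mul_conj,
    Complex.add_im, Complex.mul_im, Complex.ofReal_im, Complex.ofReal_re, mul_zero, zero_add]
  have := hT ψ
  have := mul_nonpos_of_nonpos_of_nonneg hc (Complex.normSq_nonneg ⟪e, ψ⟫_ℂ)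
  linarith

theorem IsDissipative.add_sum_smul_rankOne {ι : Type*} {T : E →L[ℂ] E} {ε : ℝ}
    (hT : IsDissipative T ε) (s : Finset ι) {c : ι → ℂ} (hc : ∀ j, (c j).im ≤ 0) (e : ι → E) :
    IsDissipative (T + ∑ j ∈ s, c j • InnerProductSpace.rankOne ℂ (e j) (e j)) ε := by
  classical
  induction s using Finset.induction_on with
  | empty => simpa using hT
  | insert j s hj ih =>
    rw [Finset.sum_insert hj, add_left_comm, add_comm]
    exact ih.add_smul_rankOne (hc j) (e j)

theorem IsUnit.apply_inverse {T : E →L[ℂ] E} (hT : IsUnit T) (ψ : E) :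
    T (Ring.inverse T ψ) = ψ := by
  have := congrArg (fun S : E →L[ℂ] E => S ψ) (Ring.mul_inverse_cancel T hT)
  simpa using this

theorem IsUnit.inverse_apply {T : E →L[ℂ] E} (hT : IsUnit T) (ψ : E) :
    Ring.inverse T (T ψ) = ψ := by
  have := congrArg (fun S : E →L[ℂ] E => S ψ) (Ring.inverse_mul_cancel T hT)
  simpa using this

variable [CompleteSpace E]

/-- This is the Lax–Milgram theorem: the quadratic form is bounded below in modulus. -/
theorem IsDissipative.isUnit {T : E →L[ℂ] E} {ε : ℝ} (hε : 0 < ε) (hT : IsDissipative T ε) :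
    IsUnit T := by
  refine T.isUnit_of_forall_le_norm_inner_map (c := ⟨ε, hε.le⟩) hε fun ψ => ?_
  rw [← norm_inner_symm, mul_comm]
  exact hT.mul_norm_sq_le ψ

theorem IsDissipative.norm_inverse_apply_le {T : E →L[ℂ] E} {ε : ℝ} (hε : 0 < ε)
    (hT : IsDissipative T ε) (ψ : E) : ‖Ring.inverse T ψ‖ ≤ ε⁻¹ * ‖ψ‖ := by
  have := hT.mul_norm_le (Ring.inverse T ψ)
  rw [(hT.isUnit hε).apply_inverse] at this
  rwa [inv_mul_eq_div, le_div_iff₀ hε, mul_comm]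

/-- With `η = T⁻¹e` one has `⟪e, T⁻¹e⟫ = conj ⟪η, Tη⟫`, and dissipativity gives the sign. -/
theorem IsDissipative.im_inner_inverse_pos {T : E →L[ℂ] E} {ε : ℝ} (hε : 0 < ε)
    (hT : IsDissipative T ε) {e : E} (he : e ≠ 0) : 0 < (⟪e, Ring.inverse T e⟫_ℂ).im := by
  set η := Ring.inverse T e with hη
  have h1 : T η = e := (hT.isUnit hε).apply_inverse e
  have h2 : η ≠ 0 := fun h => he (by rw [← h1, h, map_zero])
  have h3 := hT η
  rw [h1, ← inner_conj_symm, Complex.conj_im] at h3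
  have h4 : 0 < ε * ‖η‖ ^ 2 := by positivity
  linarith

/-- A zero would force `c = -1/g` with `Im g > 0`, and this `c` lies in the open upper half plane.
-/
theorem IsDissipative.one_add_mul_ne_zero {T : E →L[ℂ] E} {ε : ℝ} (hε : 0 < ε)
    (hT : IsDissipative T ε) {e : E} (he : e ≠ 0) {c : ℂ} (hc : c.im ≤ 0) :
    1 + c * ⟪e, Ring.inverse T e⟫_ℂ ≠ 0 := by
  intro h
  have hg := hT.im_inner_inverse_pos hε he
  set g := ⟪e, Ring.inverse T e⟫_ℂ
  have hg0 : g ≠ 0 := fun h0 => by rw [h0, Complex.zero_im] at hg; exact lt_irrefl _ hg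
  have hcg : c = -g⁻¹ := by
    field_simp
    linear_combination h
  rw [hcg, Complex.neg_im, Complex.inv_im, neg_div, neg_neg] at hc
  exact absurd hc (not_le.mpr (div_pos hg (Complex.normSq_pos.mpr hg0)))

/-- The Sherman–Morrison formula, checked by applying the perturbed operator to the proposed
solution. -/
theorem IsDissipative.inner_inverse_add_smul_rankOne {T : E →L[ℂ] E} {ε : ℝ} (hε : 0 < ε)
    (hT : IsDissipative T ε) {e : E} (he : e ≠ 0) {c : ℂ} (hc : c.im ≤ 0) (φ ψ : E) :
    ⟪φ, Ring.inverse (T + c • InnerProductSpace.rankOne ℂ e e) ψ⟫_ℂ =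
      ⟪φ, Ring.inverse T ψ⟫_ℂ - c / (1 + c * ⟪e, Ring.inverse T e⟫_ℂ) *
        (⟪e, Ring.inverse T ψ⟫_ℂ * ⟪φ, Ring.inverse T e⟫_ℂ) := by
  have h0 := hT.one_add_mul_ne_zero hε he hc
  have hu := hT.isUnit hε
  set k := c / (1 + c * ⟪e, Ring.inverse T e⟫_ℂ) * ⟪e, Ring.inverse T ψ⟫_ℂ with hk
  have h1 : (T + c • InnerProductSpace.rankOne ℂ e e)
      (Ring.inverse T ψ - k • Ring.inverse T e) = ψ := by
    rw [add_apply, smul_apply,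
      InnerProductSpace.rankOne_apply, map_sub, map_smul, hu.apply_inverse, hu.apply_inverse,
      inner_sub_right, inner_smul_right, smul_smul, sub_add_eq_add_sub, add_sub_assoc, ← sub_smul]
    have : c * (⟪e, Ring.inverse T ψ⟫_ℂ - k * ⟪e, Ring.inverse T e⟫_ℂ) - k = 0 := by
      rw [hk]
      field_simp
      ring
    rw [this, zero_smul, add_zero]
  conv_lhs => rw [← h1]
  rw [((hT.add_smul_rankOne hc e).isUnit hε).inverse_apply, inner_sub_right, inner_smul_right, hk]
  ring

/-- Averaging the inverse over a Cauchy distributed rank-one perturbation. -/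
theorem IsDissipative.integral_inner_inverse_add_smul_rankOne {T : E →L[ℂ] E} {ε : ℝ}
    (hε : 0 < ε) (hT : IsDissipative T ε) {e : E} (he : e ≠ 0) (γ : ℝ≥0) (φ ψ : E) :
    ∫ y : ℝ, ⟪φ, Ring.inverse (T + (y : ℂ) • InnerProductSpace.rankOne ℂ e e) ψ⟫_ℂ
        ∂(cauchyMeasure 0 γ) =
      ⟪φ, Ring.inverse (T + (-(γ * Complex.I)) • InnerProductSpace.rankOne ℂ e e) ψ⟫_ℂ := by
  have hγ : (0 : ℝ) ≤ γ := γ.2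
  have hcγ : (-(γ * Complex.I)).im ≤ 0 := by simp
  have hg := hT.im_inner_inverse_pos hε he
  have key (c : ℂ) (hc : c.im ≤ 0) := hT.inner_inverse_add_smul_rankOne hε he hc φ ψ
  have hne (c : ℂ) (hc : c.im ≤ 0) := hT.one_add_mul_ne_zero hε he hc
  simp_rw [fun y : ℝ => key (y : ℂ) (by simp)]
  rw [key _ hcγ]
  set g := ⟪e, Ring.inverse T e⟫_ℂ
  set b := ⟪e, Ring.inverse T ψ⟫_ℂ * ⟪φ, Ring.inverse T e⟫_ℂ
  have hg0 : g ≠ 0 := fun h0 => by rw [h0, Complex.zero_im] at hg; exact lt_irrefl _ hg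
  have hw : 0 < (-g⁻¹).im := by
    rw [Complex.neg_im, Complex.inv_im, neg_div, neg_neg]
    exact div_pos hg (Complex.normSq_pos.mpr hg0)
  -- Partial fractions: the dependence on `c` is a constant plus a multiple of `(c - w)⁻¹` with `w =
  -- -1/g` in the upper half plane, so `integral_inv_sub_cauchyMeasure` applies.
  have hfrac (c : ℂ) (hc : c.im ≤ 0) :
      c / (1 + c * g) * b = b * g⁻¹ + -(b * g⁻¹ * g⁻¹) * (c - -g⁻¹)⁻¹ := by
    have h1 := hne c hc
    have h2 : c - -g⁻¹ = (1 + c * g) * g⁻¹ := by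
      field_simp
      ring
    rw [h2, mul_inv, inv_inv]
    field_simp
    ring
  simp_rw [fun y : ℝ => hfrac (y : ℂ) (by simp)]
  rw [hfrac _ hcγ, integral_sub (integrable_const _), integral_add (integrable_const _),
    integral_const_mul (-(b * g⁻¹ * g⁻¹)), integral_inv_sub_cauchyMeasure γ hw]
  · simp
  · exact (integrable_inv_sub_of_im_pos hw).const_mul _
  · exact (integrable_const _).add ((integrable_inv_sub_of_im_pos hw).const_mul _)

section Product

variable {ι : Type*}

/-- Resampling one coordinate independently preserves the product law. This allows Fubini in a
single coordinate without splitting the index set. -/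
theorem measurePreserving_update_infinitePi [DecidableEq ι] (ν : Measure ℝ) [IsProbabilityMeasure ν]
    (j : ι) :
    MeasurePreserving (fun p : (ι → ℝ) × ℝ => Function.update p.1 j p.2)
      ((Measure.infinitePi fun _ : ι => ν).prod ν) (Measure.infinitePi fun _ : ι => ν) := by
  have hm : Measurable fun p : (ι → ℝ) × ℝ => Function.update p.1 j p.2 := by
    refine measurable_pi_iff.mpr fun i => ?_
    rcases eq_or_ne i j with rfl | h
    · simpa using measurable_snd
    · simp only [Function.update_of_ne h]
      exact (measurable_pi_apply i).comp measurable_fst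
  refine ⟨hm, Measure.eq_infinitePi (fun _ => ν) fun s t ht => ?_⟩
  rw [Measure.map_apply hm (MeasurableSet.pi s.countable_toSet fun i _ => ht i)]
  by_cases hj : j ∈ s
  · have : (fun p : (ι → ℝ) × ℝ => Function.update p.1 j p.2) ⁻¹' (Set.pi s t) =
        (Set.pi (s.erase j) t) ×ˢ t j := by
      ext p
      simp only [Set.mem_preimage, Set.mem_pi, Set.mem_prod, Finset.mem_coe, Finset.mem_erase]
      refine ⟨fun h => ⟨fun i hi => ?_, ?_⟩, fun h i hi => ?_⟩
      · simpa [Function.update_of_ne hi.1] using h i hi.2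
      · simpa using h j hj
      · rcases eq_or_ne i j with rfl | hij
        · simpa using h.2
        · simpa [Function.update_of_ne hij] using h.1 i ⟨hij, hi⟩
    rw [this, Measure.prod_prod, Measure.infinitePi_pi _ fun i _ => ht i,
      ← Finset.prod_erase_mul s _ hj]
  · have : (fun p : (ι → ℝ) × ℝ => Function.update p.1 j p.2) ⁻¹' (Set.pi s t) =
        (Set.pi s t) ×ˢ Set.univ := by
      ext p
      simp only [Set.mem_preimage, Set.mem_pi, Set.mem_prod, Finset.mem_coe, Set.mem_univ, and_true]
      refine forall₂_congr fun i hi => ?_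
      rw [Function.update_of_ne (ne_of_mem_of_not_mem hi hj)]
    rw [this, Measure.prod_prod, Measure.infinitePi_pi _ fun i _ => ht i, measure_univ, mul_one]

theorem IsDissipative.continuous_inner_inverse_add_sum {T : E →L[ℂ] E} {ε : ℝ} (hε : 0 < ε)
    (hT : IsDissipative T ε) (e : ι → E) (s : Finset ι) (φ ψ : E) :
    Continuous fun ω : ι → ℝ =>
      ⟪φ, Ring.inverse (T + ∑ j ∈ s, (ω j : ℂ) • InnerProductSpace.rankOne ℂ (e j) (e j)) ψ⟫_ℂ := by
  have h1 : Continuous fun ω : ι → ℝ =>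
      T + ∑ j ∈ s, (ω j : ℂ) • InnerProductSpace.rankOne ℂ (e j) (e j) := by fun_prop
  have h2 : Continuous fun ω : ι → ℝ =>
      Ring.inverse (T + ∑ j ∈ s, (ω j : ℂ) • InnerProductSpace.rankOne ℂ (e j) (e j)) := by
    refine continuous_iff_continuousAt.mpr fun ω => ?_
    obtain ⟨u, hu⟩ := (hT.add_sum_smul_rankOne s (c := fun j => (ω j : ℂ)) (by simp) e).isUnit hε
    have h3 := NormedRing.inverse_continuousAt u
    rw [hu] at h3
    exact ContinuousAt.comp (g := Ring.inverse) h3 h1.continuousAt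
  exact continuous_const.inner (h2.clm_apply continuous_const)

theorem IsDissipative.norm_inner_inverse_add_sum_le {T : E →L[ℂ] E} {ε : ℝ} (hε : 0 < ε)
    (hT : IsDissipative T ε) (e : ι → E) (s : Finset ι) (φ ψ : E) (ω : ι → ℝ) :
    ‖⟪φ, Ring.inverse (T + ∑ j ∈ s, (ω j : ℂ) • InnerProductSpace.rankOne ℂ (e j) (e j)) ψ⟫_ℂ‖ ≤
      ‖φ‖ * (ε⁻¹ * ‖ψ‖) :=
  (norm_inner_le_norm _ _).trans <| mul_le_mul_of_nonneg_left
    ((hT.add_sum_smul_rankOne s (c := fun j => (ω j : ℂ)) (by simp) e).norm_inverse_apply_le hε ψ)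
    (norm_nonneg _)

/-- Averaging the inverse over finitely many independent Cauchy distributed rank-one
perturbations. -/
theorem IsDissipative.integral_inner_inverse_add_sum [Countable ι] {T : E →L[ℂ] E} {ε : ℝ}
    (hε : 0 < ε) (hT : IsDissipative T ε) {e : ι → E} (he : ∀ j, e j ≠ 0) (s : Finset ι)
    (γ : ℝ≥0) (φ ψ : E) :
    ∫ ω : ι → ℝ,
        ⟪φ, Ring.inverse (T + ∑ j ∈ s, (ω j : ℂ) • InnerProductSpace.rankOne ℂ (e j) (e j)) ψ⟫_ℂ
        ∂(Measure.infinitePi fun _ : ι => cauchyMeasure 0 γ) =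
      ⟪φ, Ring.inverse (T + ∑ j ∈ s, (-(γ * Complex.I)) •
        InnerProductSpace.rankOne ℂ (e j) (e j)) ψ⟫_ℂ := by
  classical
  have hcγ : (-(γ * Complex.I)).im ≤ 0 := by simp
  -- The operator varies: after averaging over the site `j`, its term `-iγ P_j` is absorbed into
  -- `T`, which stays dissipative, and the induction hypothesis is applied to the new operator.
  induction s using Finset.induction_on generalizing T with
  | empty => simp
  | insert j s hj ih =>
    have hcont := hT.continuous_inner_inverse_add_sum hε e (insert j s) φ ψ
    have hmp := measurePreserving_update_infinitePi (ι := ι) (cauchyMeasure 0 γ) j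
    rw [← hmp.map_eq, integral_map hmp.aemeasurable hcont.measurable.aestronglyMeasurable,
      integral_prod]
    · have h1 (ω : ι → ℝ) : ∫ y : ℝ, ⟪φ, Ring.inverse (T + ∑ i ∈ insert j s,
            ((Function.update ω j y i : ℝ) : ℂ) • InnerProductSpace.rankOne ℂ (e i) (e i)) ψ⟫_ℂ
            ∂(cauchyMeasure 0 γ) =
          ⟪φ, Ring.inverse ((T + (-(γ * Complex.I)) • InnerProductSpace.rankOne ℂ (e j) (e j)) +
            ∑ i ∈ s, (ω i : ℂ) • InnerProductSpace.rankOne ℂ (e i) (e i)) ψ⟫_ℂ := by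
        have h2 (y : ℝ) : T + ∑ i ∈ insert j s,
            ((Function.update ω j y i : ℝ) : ℂ) • InnerProductSpace.rankOne ℂ (e i) (e i) =
            (T + ∑ i ∈ s, (ω i : ℂ) • InnerProductSpace.rankOne ℂ (e i) (e i)) +
              (y : ℂ) • InnerProductSpace.rankOne ℂ (e j) (e j) := by
          rw [Finset.sum_insert hj, Function.update_self, add_left_comm, add_comm]
          congr 2
          refine Finset.sum_congr rfl fun i hi => ?_
          rw [Function.update_of_ne (ne_of_mem_of_not_mem hi hj)]
        simp_rw [h2]
        rw [(hT.add_sum_smul_rankOne s (c := fun j => (ω j : ℂ)) (by simp)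
          e).integral_inner_inverse_add_smul_rankOne hε (he j), add_right_comm]
      simp_rw [h1]
      rw [ih (hT.add_smul_rankOne hcγ (e j)), Finset.sum_insert hj, add_assoc]
    · refine Integrable.of_bound (C := ‖φ‖ * (ε⁻¹ * ‖ψ‖))
        (hcont.measurable.comp hmp.measurable).aestronglyMeasurable
        (Eventually.of_forall fun p => ?_)
      exact hT.norm_inner_inverse_add_sum_le hε e (insert j s) φ ψ _

end Product

end Dissipative

/-! ### Averaged resolvents of the Anderson Hamiltonian -/

section AveragedResolvent

variable {d : ℕ}

/-- The projection onto the site `j`. -/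
abbrev siteProj (j : LatticeSite d) : LatticeL2 d →L[ℂ] LatticeL2 d :=
  InnerProductSpace.rankOne ℂ (siteVector j) (siteVector j)

theorem siteVector_ne_zero (j : LatticeSite d) : siteVector j ≠ 0 := by
  rw [← norm_ne_zero_iff, norm_siteVector]
  exact one_ne_zero

theorem latticeLaplacian_sub_smul_apply (z : ℂ) (ψ : LatticeL2 d) :
    (latticeLaplacian d - z • (1 : LatticeL2 d →L[ℂ] LatticeL2 d)) ψ =
      latticeLaplacian d ψ - z • ψ := rfl

theorem isDissipative_latticeLaplacian_sub (z : ℂ) :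
    IsDissipative (latticeLaplacian d - z • 1) z.im := by
  intro ψ
  rw [latticeLaplacian_sub_smul_apply, inner_sub_right, inner_smul_right,
    inner_self_eq_norm_sq_to_K, Complex.sub_im, im_inner_latticeLaplacian_self, zero_sub, neg_le_neg_iff]
  simp [← Complex.ofReal_pow]

theorem isDissipative_truncated {z : ℂ} {v : LatticeSite d → ℂ} (hv : ∀ j, (v j).im ≤ 0)
    (s : Finset (LatticeSite d)) :
    IsDissipative (latticeLaplacian d - z • 1 + ∑ j ∈ s, v j • siteProj j) z.im :=
  (isDissipative_latticeLaplacian_sub z).add_sum_smul_rankOne s hv _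

/-- Strong resolvent convergence of the truncations of a dissipative potential. -/
theorem tendsto_inverse_truncated {z : ℂ} (hz : 0 < z.im) {v : LatticeSite d → ℂ}
    (hv : ∀ j, (v j).im ≤ 0) (ψ : LatticeL2 d) (hψ : Memℓp (fun x => v x * ψ x) 2) :
    Tendsto (fun s : Finset (LatticeSite d) =>
      Ring.inverse (latticeLaplacian d - z • 1 + ∑ j ∈ s, v j • siteProj j)
        (latticeLaplacian d ψ + ⟨fun x => v x * ψ x, hψ⟩ - z • ψ)) atTop (𝓝 ψ) := by
  set η : LatticeL2 d := ⟨fun x => v x * ψ x, hψ⟩ with hη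
  have hsum : HasSum (fun j => v j • siteProj j ψ) η := by
    have h := lp.hasSum_single (E := fun _ : LatticeSite d => ℂ) (p := 2) (by norm_num) η
    convert h using 2 with j
    rw [InnerProductSpace.rankOne_apply, inner_siteVector, smul_smul, siteVector]
    refine lp.ext (funext fun x => ?_)
    rw [lp.coeFn_smul, Pi.smul_apply, smul_eq_mul, lp.single_apply, lp.single_apply,
      Pi.single_apply, Pi.single_apply]
    split_ifs
    · rw [mul_one]
    · rw [mul_zero]
  rw [tendsto_iff_norm_sub_tendsto_zero]
  have hlim : Tendsto (fun s : Finset (LatticeSite d) =>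
      z.im⁻¹ * ‖η - ∑ j ∈ s, v j • siteProj j ψ‖) atTop (𝓝 0) := by
    have h1 : Tendsto (fun s : Finset (LatticeSite d) => η - ∑ j ∈ s, v j • siteProj j ψ) atTop
        (𝓝 (η - η)) := tendsto_const_nhds.sub hsum
    rw [sub_self] at h1
    simpa using h1.norm.const_mul z.im⁻¹
  refine squeeze_zero (fun _ => norm_nonneg _) (fun s => ?_) hlim
  have hd := isDissipative_truncated (z := z) hv s
  set T := latticeLaplacian d - z • 1 + ∑ j ∈ s, v j • siteProj j with hT
  -- The truncated operator misses the target only by the tail of `η`, and its inverse is bounded by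
  -- `1 / Im z` uniformly in `s`.
  have h2 : latticeLaplacian d ψ + η - z • ψ = T ψ + (η - ∑ j ∈ s, v j • siteProj j ψ) := by
    rw [hT, add_apply, latticeLaplacian_sub_smul_apply, sum_apply]
    simp only [smul_apply]
    abel
  rw [h2, map_add, (hd.isUnit hz).inverse_apply, add_sub_cancel_left]
  exact hd.norm_inverse_apply_le hz _

/-- The uniform probability measure on the torus, represented by `(0, 1]^d`. -/
abbrev torusMeasure (d : ℕ) : Measure (Fin d → ℝ) :=
  Measure.pi fun _ => volume.restrict (Set.Ioc 0 1)

instance : IsProbabilityMeasure ((volume : Measure ℝ).restrict (Set.Ioc 0 1)) :=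
  ⟨by simp⟩

/-- The symbol `∑ᵢ 2 cos (2π uᵢ)` of the lattice Laplacian. -/
def latticeSymbol (u : Fin d → ℝ) : ℝ := ∑ i, 2 * Real.cos (2 * Real.pi * u i)

@[fun_prop]
theorem continuous_latticeSymbol : Continuous (latticeSymbol (d := d)) := by
  unfold latticeSymbol
  fun_prop

/-- The character of the torus with frequency `x`. -/
def torusChar (x : LatticeSite d) (u : Fin d → ℝ) : ℂ :=
  ∏ i, Complex.exp (2 * Real.pi * x i * u i * Complex.I)

@[fun_prop]
theorem continuous_torusChar (x : LatticeSite d) : Continuous (torusChar x) := by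
  unfold torusChar
  fun_prop

theorem norm_torusChar (x : LatticeSite d) (u : Fin d → ℝ) : ‖torusChar x u‖ = 1 := by
  rw [torusChar, norm_prod]
  refine Finset.prod_eq_one fun i _ => ?_
  rw [Complex.norm_exp]
  simp

theorem torusChar_add (x y : LatticeSite d) (u : Fin d → ℝ) :
    torusChar (x + y) u = torusChar x u * torusChar y u := by
  simp only [torusChar, ← Finset.prod_mul_distrib, ← Complex.exp_add, Pi.add_apply]
  refine Finset.prod_congr rfl fun i _ => ?_
  push_cast
  ring_nf

theorem conj_torusChar (x : LatticeSite d) (u : Fin d → ℝ) :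
    starRingEnd ℂ (torusChar x u) = torusChar (-x) u := by
  simp only [torusChar, map_prod, ← Complex.exp_conj]
  refine Finset.prod_congr rfl fun i _ => ?_
  simp [map_ofNat]

theorem torusChar_zero (u : Fin d → ℝ) : torusChar 0 u = 1 := by
  simp [torusChar]

theorem torusChar_single (i : Fin d) (n : ℤ) (u : Fin d → ℝ) :
    torusChar (Pi.single i n) u = Complex.exp (2 * Real.pi * n * u i * Complex.I) := by
  rw [torusChar, Finset.prod_eq_single i]
  · simp
  · intro j _ hj
    simp [Pi.single_eq_of_ne hj]
  · simp

theorem integral_torusChar (x : LatticeSite d) :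
    ∫ u, torusChar x u ∂(torusMeasure d) = if x = 0 then 1 else 0 := by
  unfold torusChar
  rw [integral_fintype_prod_eq_prod (𝕜 := ℂ)
    (fun i (t : ℝ) => Complex.exp (2 * Real.pi * x i * t * Complex.I))]
  have h (n : ℤ) : ∫ t in Set.Ioc (0 : ℝ) 1, Complex.exp (2 * Real.pi * n * t * Complex.I) =
      if n = 0 then 1 else 0 := by
    split_ifs with hn
    · simp [hn]
    · have hne : (2 * Real.pi * n * Complex.I : ℂ) ≠ 0 := by
        simp [hn, Real.pi_ne_zero]
      rw [← intervalIntegral.integral_of_le zero_le_one]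
      have h1 (t : ℝ) : Complex.exp (2 * Real.pi * n * t * Complex.I) =
          Complex.exp (2 * Real.pi * n * Complex.I * t) := by ring_nf
      simp_rw [h1]
      rw [integral_exp_mul_complex hne]
      have h2 : Complex.exp (2 * Real.pi * n * Complex.I * (1 : ℝ)) = 1 := by
        rw [Complex.exp_eq_one_iff]
        exact ⟨n, by push_cast; ring⟩
      rw [h2]
      simp
  simp_rw [h]
  split_ifs with hx
  · simp [hx]
  · obtain ⟨i, hi⟩ := Function.ne_iff.mp hx
    exact Finset.prod_eq_zero (Finset.mem_univ i) (if_neg hi)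

theorem sum_torusChar_eq_latticeSymbol (u : Fin d → ℝ) :
    ∑ i : Fin d, (torusChar (Pi.single i 1) u + torusChar (-Pi.single i 1) u) =
      latticeSymbol u := by
  rw [latticeSymbol]
  push_cast
  refine Finset.sum_congr rfl fun i _ => ?_
  rw [← Pi.single_neg, torusChar_single, torusChar_single, Complex.two_cos]
  push_cast
  ring_nf

theorem memLp_of_continuous_of_bound {f : (Fin d → ℝ) → ℂ} (hf : Continuous f) {C : ℝ}
    (hC : ∀ u, ‖f u‖ ≤ C) (p : ℝ≥0∞) : MemLp f p (torusMeasure d) :=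
  MemLp.of_bound hf.aestronglyMeasurable C (Eventually.of_forall hC)

/-- Bessel's inequality for the orthonormal family of characters. -/
theorem summable_sq_integral_torusChar_mul {f : (Fin d → ℝ) → ℂ} (hf : Continuous f) {C : ℝ}
    (hC : ∀ u, ‖f u‖ ≤ C) :
    Summable fun x : LatticeSite d => ‖∫ u, torusChar (-x) u * f u ∂(torusMeasure d)‖ ^ 2 := by
  have hm (x : LatticeSite d) : MemLp (torusChar x) 2 (torusMeasure d) :=
    memLp_of_continuous_of_bound (by fun_prop) (fun u => (norm_torusChar x u).le) 2
  have hmf := memLp_of_continuous_of_bound hf hC 2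
  have hinner (x : LatticeSite d) {g : (Fin d → ℝ) → ℂ} (hg : MemLp g 2 (torusMeasure d)) :
      ⟪(hm x).toLp, hg.toLp⟫_ℂ = ∫ u, torusChar (-x) u * g u ∂(torusMeasure d) := by
    rw [L2.inner_def]
    refine integral_congr_ae ?_
    filter_upwards [(hm x).coeFn_toLp, hg.coeFn_toLp] with u h1 h2
    rw [h1, h2, RCLike.inner_apply, conj_torusChar, mul_comm]
  have horth : Orthonormal ℂ fun x => (hm x).toLp := by
    rw [orthonormal_iff_ite]
    intro x y
    rw [hinner]
    simp_rw [← torusChar_add]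
    rw [integral_torusChar]
    simp only [neg_add_eq_zero]
  have := horth.inner_products_summable (x := hmf.toLp)
  simpa only [hinner] using this

/-- The free Green's function. -/
theorem exists_latticeGreen {z : ℂ} (hz : z.im ≠ 0) :
    ∃ G : LatticeL2 d, latticeLaplacian d G - z • G = siteVector 0 ∧
      G 0 = ∫ u, ((latticeSymbol u : ℂ) - z)⁻¹ ∂(torusMeasure d) := by
  set f : (Fin d → ℝ) → ℂ := fun u => ((latticeSymbol u : ℂ) - z)⁻¹ with hf
  have hne (u : Fin d → ℝ) : (latticeSymbol u : ℂ) - z ≠ 0 := fun h => hz (by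
    simpa using congrArg Complex.im h)
  have hfc : Continuous f := by
    rw [hf]
    exact Continuous.inv₀ (by fun_prop) hne
  have hfb (u : Fin d → ℝ) : ‖f u‖ ≤ |z.im|⁻¹ := by
    rw [hf]
    dsimp only
    rw [norm_inv]
    refine inv_anti₀ (abs_pos.mpr hz) ?_
    have := Complex.abs_im_le_norm ((latticeSymbol u : ℂ) - z)
    rwa [Complex.sub_im, Complex.ofReal_im, zero_sub, abs_neg] at this
  have hint (g : (Fin d → ℝ) → ℂ) (hg : Continuous g) (C : ℝ) (hC : ∀ u, ‖g u‖ ≤ C) :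
      Integrable g (torusMeasure d) :=
    memLp_one_iff_integrable.mp (memLp_of_continuous_of_bound hg hC 1)
  have hint' (x : LatticeSite d) : Integrable (fun u => torusChar x u * f u) (torusMeasure d) :=
    hint _ (by fun_prop) |z.im|⁻¹ fun u => by rw [norm_mul, norm_torusChar, one_mul]; exact hfb u
  have hmem : Memℓp (fun x : LatticeSite d => ∫ u, torusChar (-x) u * f u ∂(torusMeasure d)) 2 := by
    rw [memℓp_gen_iff (by norm_num)]
    simpa using summable_sq_integral_torusChar_mul hfc hfb
  -- The solution consists of the Fourier coefficients of `(symbol - z)⁻¹`: shifting the frequency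
  -- in both directions and summing multiplies the integrand by the symbol.
  refine ⟨⟨_, hmem⟩, lp.ext (funext fun x => ?_), ?_⟩
  · rw [lp.coeFn_sub, Pi.sub_apply, lp.coeFn_smul, Pi.smul_apply, smul_eq_mul,
      latticeLaplacian_apply, siteVector_apply]
    change ∑ i : Fin d, (∫ u, torusChar (-(x + Pi.single i 1)) u * f u ∂(torusMeasure d) +
      ∫ u, torusChar (-(x - Pi.single i 1)) u * f u ∂(torusMeasure d)) -
      z * ∫ u, torusChar (-x) u * f u ∂(torusMeasure d) = _
    have hint2 (i : Fin d) : Integrable (fun u => torusChar (-(x + Pi.single i 1)) u * f u +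
        torusChar (-(x - Pi.single i 1)) u * f u) (torusMeasure d) := (hint' _).add (hint' _)
    simp_rw [← integral_add (hint' _) (hint' _)]
    rw [← integral_finsetSum _ fun i _ => hint2 i, ← integral_const_mul,
      ← integral_sub (integrable_finsetSum _ fun i _ => hint2 i) ((hint' _).const_mul z)]
    have h1 (u : Fin d → ℝ) : ∑ i : Fin d, (torusChar (-(x + Pi.single i 1)) u * f u +
        torusChar (-(x - Pi.single i 1)) u * f u) - z * (torusChar (-x) u * f u) =
        torusChar (-x) u := by
      have h2 : ∑ i : Fin d, (torusChar (-(x + Pi.single i 1)) u * f u +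
          torusChar (-(x - Pi.single i 1)) u * f u) =
          torusChar (-x) u * f u * latticeSymbol u := by
        rw [← sum_torusChar_eq_latticeSymbol, Finset.mul_sum]
        refine Finset.sum_congr rfl fun i _ => ?_
        rw [neg_add, neg_sub', sub_neg_eq_add, torusChar_add, torusChar_add]
        ring
      rw [h2]
      have h3 : f u * ((latticeSymbol u : ℂ) - z) = 1 := inv_mul_cancel₀ (hne u)
      linear_combination torusChar (-x) u * h3
    simp_rw [h1]
    rw [integral_torusChar]
    simp
  · change ∫ u, torusChar (-0) u * f u ∂(torusMeasure d) = _
    simp [torusChar_zero, hf]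

/-- Every `φ` is `(H_ω - z)ψ` for `ψ` the resolvent applied to `φ`, which lies in the domain; the
convergence of truncations is applied to this `ψ`. -/
theorem tendsto_inverse_truncated_anderson {z : ℂ} (hz : 0 < z.im) (ω : LatticeSite d → ℝ)
    (φ : LatticeL2 d) :
    Tendsto (fun s : Finset (LatticeSite d) =>
      Ring.inverse (latticeLaplacian d - z • 1 + ∑ j ∈ s, (ω j : ℂ) • siteProj j) φ) atTop
      (𝓝 (resolventAt (anderson ω) z φ)) := by
  obtain ⟨h, h'⟩ := ((isSelfAdjoint_anderson ω).isResolventAt_resolventAt hz.ne').1 φ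
  have := tendsto_inverse_truncated hz (v := fun j => (ω j : ℂ)) (by simp)
    (resolventAt (anderson ω) z φ) (mem_andersonDomain.mp h)
  convert this using 3
  conv_lhs => rw [← h', anderson_apply]

theorem inner_inverse_truncated_tendsto {z : ℂ} (hz : 0 < z.im) (ω : LatticeSite d → ℝ)
    (φ : LatticeL2 d) :
    Tendsto (fun s : Finset (LatticeSite d) =>
      ⟪φ, Ring.inverse (latticeLaplacian d - z • 1 + ∑ j ∈ s, (ω j : ℂ) • siteProj j) φ⟫_ℂ) atTop
      (𝓝 ⟪φ, resolventAt (anderson ω) z φ⟫_ℂ) :=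
  tendsto_const_nhds.inner (tendsto_inverse_truncated_anderson hz ω φ)

theorem measurable_inner_resolventAt {z : ℂ} (hz : 0 < z.im) (φ : LatticeL2 d) :
    Measurable fun ω : LatticeSite d → ℝ => ⟪φ, resolventAt (anderson ω) z φ⟫_ℂ := by
  refine measurable_of_tendsto_metrizable' (atTop : Filter (Finset (LatticeSite d)))
    (f := fun (s : Finset (LatticeSite d)) (ω : LatticeSite d → ℝ) =>
      ⟪φ, Ring.inverse (latticeLaplacian d - z • 1 + ∑ j ∈ s, (ω j : ℂ) • siteProj j) φ⟫_ℂ)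
    (fun s => ?_) (tendsto_pi_nhds.mpr fun ω => inner_inverse_truncated_tendsto hz ω φ)
  exact ((isDissipative_latticeLaplacian_sub z).continuous_inner_inverse_add_sum hz siteVector s
    φ φ).measurable

/-- The averaged resolvent of the Lloyd model is the free resolvent with spectral parameter shifted
by `iγ`. -/
theorem integral_inner_resolventAt (γ : ℝ≥0) {z : ℂ} (hz : 0 < z.im) :
    ∫ ω, ⟪siteVector (0 : LatticeSite d), resolventAt (anderson ω) z (siteVector 0)⟫_ℂ
        ∂(Measure.infinitePi fun _ : LatticeSite d => cauchyMeasure 0 γ) =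
      ∫ u, ((latticeSymbol u : ℂ) - (z + γ * Complex.I))⁻¹ ∂(torusMeasure d) := by
  have hγ : (0 : ℝ) ≤ γ := γ.2
  have hd := isDissipative_latticeLaplacian_sub (d := d) z
  obtain ⟨G, hG, hG0⟩ := exists_latticeGreen (d := d) (z := z + γ * Complex.I) (by
    simp; linarith)
  rw [← hG0, ← inner_siteVector]
  have h1 := tendsto_integral_filter_of_dominated_convergence
    (μ := Measure.infinitePi fun _ : LatticeSite d => cauchyMeasure 0 γ)
    (l := (atTop : Filter (Finset (LatticeSite d))))
    (F := fun (s : Finset (LatticeSite d)) (ω : LatticeSite d → ℝ) => ⟪siteVector (0 : LatticeSite d),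
      Ring.inverse (latticeLaplacian d - z • 1 + ∑ j ∈ s, (ω j : ℂ) • siteProj j)
        (siteVector 0)⟫_ℂ)
    (f := fun ω => ⟪siteVector (0 : LatticeSite d),
      resolventAt (anderson ω) z (siteVector 0)⟫_ℂ)
    (fun _ => ‖siteVector (0 : LatticeSite d)‖ * (z.im⁻¹ * ‖siteVector (0 : LatticeSite d)‖))
    (Eventually.of_forall fun s =>
      (hd.continuous_inner_inverse_add_sum hz siteVector s _ _).aestronglyMeasurable)
    (Eventually.of_forall fun s => Eventually.of_forall fun ω =>
      hd.norm_inner_inverse_add_sum_le hz siteVector s _ _ ω)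
    (integrable_const _)
    (Eventually.of_forall fun ω => inner_inverse_truncated_tendsto hz ω _)
  refine tendsto_nhds_unique h1 ?_
  simp_rw [hd.integral_inner_inverse_add_sum hz siteVector_ne_zero]
  have hmem : Memℓp (fun x => -(γ * Complex.I) * G x) 2 := (lp.memℓp G).const_mul _
  -- The same convergence theorem is now used for the constant potential `-iγ`: `G` solves `(Δ - iγ
  -- - z)G = δ₀`, so the averaged truncations tend to `G 0`.
  have h2 := tendsto_inverse_truncated hz (v := fun _ => -(γ * Complex.I)) (by simp) G hmem
  have h3 : latticeLaplacian d G + ⟨fun x => -(γ * Complex.I) * G x, hmem⟩ - z • G =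
      siteVector 0 := by
    rw [← hG]
    refine lp.ext (funext fun x => ?_)
    simp only [lp.coeFn_sub, lp.coeFn_add, lp.coeFn_smul, Pi.sub_apply, Pi.add_apply,
      Pi.smul_apply, smul_eq_mul]
    ring
  rw [h3] at h2
  exact tendsto_const_nhds.inner h2

end AveragedResolvent

/-! ### The functional calculus through the resolvent at `i` -/

section Circle

open scoped ContinuousMapZero

/-- The closure of the image of `ℝ` under `x ↦ (x - i)⁻¹`. -/
def resolventCircle : Set ℂ := {w | Complex.normSq w = w.im}

instance : Fact ((0 : ℂ) ∈ resolventCircle) := ⟨by simp [resolventCircle]⟩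

theorem norm_le_one_of_mem_resolventCircle {w : ℂ} (hw : w ∈ resolventCircle) : ‖w‖ ≤ 1 := by
  have h1 : Complex.normSq w = w.im := hw
  rw [Complex.normSq_eq_norm_sq] at h1
  have h2 := (le_abs_self _).trans (Complex.abs_im_le_norm w)
  nlinarith [norm_nonneg w]

instance : CompactSpace resolventCircle := by
  rw [← isCompact_iff_compactSpace]
  refine Metric.isCompact_of_isClosed_isBounded
    (isClosed_eq Complex.continuous_normSq Complex.continuous_im) ?_
  exact (Metric.isBounded_closedBall (x := (0 : ℂ)) (r := 1)).subset fun w hw =>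
    mem_closedBall_zero_iff.mpr (norm_le_one_of_mem_resolventCircle hw)

theorem inv_add_I_of_mem_resolventCircle {w : ℂ} (hw : w ∈ resolventCircle) (h0 : w ≠ 0) :
    w⁻¹ + Complex.I = ((w⁻¹ + Complex.I).re : ℂ) := by
  have h1 : Complex.normSq w = w.im := hw
  have h2 : w.im ≠ 0 := by rw [← h1]; exact (Complex.normSq_pos.mpr h0).ne'
  refine Complex.ext (by simp) ?_
  rw [Complex.add_im, Complex.inv_im, h1, Complex.ofReal_im, Complex.I_im, neg_div, div_self h2]
  ring

theorem ofReal_sub_I_ne_zero (x : ℝ) : (x : ℂ) - Complex.I ≠ 0 := fun h => by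
  simpa using congrArg Complex.im h

theorem inv_sub_I_mem_resolventCircle (x : ℝ) : ((x : ℂ) - Complex.I)⁻¹ ∈ resolventCircle := by
  change Complex.normSq _ = _
  rw [Complex.inv_im, Complex.normSq_inv]
  simp

/-- The map `x ↦ (x - i)⁻¹` into the circle. -/
def toCircle (x : ℝ) : resolventCircle := ⟨((x : ℂ) - Complex.I)⁻¹, inv_sub_I_mem_resolventCircle x⟩

theorem continuous_toCircle : Continuous toCircle :=
  Continuous.subtype_mk (Continuous.inv₀ (by fun_prop) ofReal_sub_I_ne_zero) _

/-- A zero would give `w⁻¹ + i = z`, whereas `w⁻¹ + i` is real on the circle. -/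
theorem one_add_mul_ne_zero_of_mem_resolventCircle {z w : ℂ} (hz : z.im ≠ 0)
    (hw : w ∈ resolventCircle) : 1 + (Complex.I - z) * w ≠ 0 := by
  intro h
  have h0 : w ≠ 0 := by
    rintro rfl
    simp at h
  have h1 := inv_add_I_of_mem_resolventCircle hw h0
  have h2 : w⁻¹ + Complex.I = z := by
    field_simp
    linear_combination h
  rw [h2] at h1
  exact hz (by rw [h1, Complex.ofReal_im])

/-- The function `x ↦ (x - z)⁻¹` in the coordinate `w = (x - i)⁻¹`. -/
def circleResolvent (z : ℂ) (hz : z.im ≠ 0) : C(resolventCircle, ℂ)₀ where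
  toFun w := w / (1 + (Complex.I - z) * w)
  continuous_toFun := Continuous.div (by fun_prop) (by fun_prop) fun w =>
    one_add_mul_ne_zero_of_mem_resolventCircle hz w.2
  map_zero' := by
    change (0 : ℂ) / _ = 0
    simp

theorem circleResolvent_apply {z : ℂ} (hz : z.im ≠ 0) (w : resolventCircle) :
    circleResolvent z hz w = w / (1 + (Complex.I - z) * w) := rfl

theorem circleResolvent_toCircle {z : ℂ} (hz : z.im ≠ 0) (x : ℝ) :
    circleResolvent z hz (toCircle x) = ((x : ℂ) - z)⁻¹ := by
  have h1 := ofReal_sub_I_ne_zero x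
  have h2 : (x : ℂ) - z ≠ 0 := fun h => hz (by simpa using congrArg Complex.im h)
  rw [circleResolvent_apply]
  change ((x : ℂ) - Complex.I)⁻¹ / (1 + (Complex.I - z) * ((x : ℂ) - Complex.I)⁻¹) = _
  have h3 : 1 + (Complex.I - z) * ((x : ℂ) - Complex.I)⁻¹ =
      ((x : ℂ) - z) * ((x : ℂ) - Complex.I)⁻¹ := by
    field_simp
    ring
  rw [h3]
  field_simp

theorem eq_zero_or_eq_toCircle (w : resolventCircle) : w = 0 ∨ ∃ x : ℝ, w = toCircle x := by
  by_cases h0 : (w : ℂ) = 0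
  · exact Or.inl (Subtype.ext h0)
  · refine Or.inr ⟨((w : ℂ)⁻¹ + Complex.I).re, Subtype.ext ?_⟩
    change (w : ℂ) = ((((w : ℂ)⁻¹ + Complex.I).re : ℂ) - Complex.I)⁻¹
    rw [← inv_add_I_of_mem_resolventCircle w.2 h0, add_sub_cancel_right, inv_inv]

theorem norm_circleResolvent_le {z : ℂ} (hz : z.im ≠ 0) :
    ‖circleResolvent z hz‖ ≤ |z.im|⁻¹ := by
  rw [ContinuousMapZero.norm_def, ContinuousMap.norm_le _ (by positivity)]
  intro w
  change ‖circleResolvent z hz w‖ ≤ _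
  rcases eq_zero_or_eq_toCircle w with rfl | ⟨x, rfl⟩
  · rw [map_zero, norm_zero]
    positivity
  · rw [circleResolvent_toCircle, norm_inv]
    refine inv_anti₀ (abs_pos.mpr hz) ?_
    have := Complex.abs_im_le_norm ((x : ℂ) - z)
    rwa [Complex.sub_im, Complex.ofReal_im, zero_sub, abs_neg] at this

theorem circleResolvent_sub {z w : ℂ} (hz : z.im ≠ 0) (hw : w.im ≠ 0) :
    circleResolvent z hz - circleResolvent w hw =
      (z - w) • (circleResolvent z hz * circleResolvent w hw) := by
  ext p
  rw [ContinuousMapZero.coe_sub, ContinuousMapZero.coe_smul, ContinuousMapZero.coe_mul,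
    Pi.sub_apply, Pi.smul_apply, Pi.mul_apply, circleResolvent_apply, circleResolvent_apply,
    smul_eq_mul]
  have h1 := one_add_mul_ne_zero_of_mem_resolventCircle hz p.2
  have h2 := one_add_mul_ne_zero_of_mem_resolventCircle hw p.2
  rw [div_sub_div _ _ h1 h2, div_mul_div_comm, ← mul_div_assoc]
  congr 1
  ring

/-- The resolvent functions span a dense subspace. -/
theorem circleResolvent_mem_submodule_eq_top (M : Submodule ℂ C(resolventCircle, ℂ)₀)
    (hM : IsClosed (M : Set C(resolventCircle, ℂ)₀))
    (h : ∀ z (hz : z.im ≠ 0), circleResolvent z hz ∈ M) (g : C(resolventCircle, ℂ)₀) : g ∈ M := by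
  -- The closed span of the resolvent functions is closed under multiplication, since the resolvent
  -- identity turns products into differences. It contains the coordinate and its conjugate (the
  -- resolvents at `i` and `-i`), so Stone–Weierstrass applies.
  set G : Set C(resolventCircle, ℂ)₀ := {g | ∃ z, ∃ hz : z.im ≠ 0, g = circleResolvent z hz} with hG
  set S := (Submodule.span ℂ G).topologicalClosure with hS
  have hSc : IsClosed (S : Set C(resolventCircle, ℂ)₀) := Submodule.isClosed_topologicalClosure _
  have hGS (z : ℂ) (hz : z.im ≠ 0) : circleResolvent z hz ∈ S :=
    Submodule.le_topologicalClosure _ (Submodule.subset_span ⟨z, hz, rfl⟩)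
  have hmin (N : Submodule ℂ C(resolventCircle, ℂ)₀)
      (hN : IsClosed (N : Set C(resolventCircle, ℂ)₀))
      (hN' : ∀ z (hz : z.im ≠ 0), circleResolvent z hz ∈ N) : S ≤ N := by
    refine Submodule.topologicalClosure_minimal _ (Submodule.span_le.mpr ?_) hN
    rintro _ ⟨z, hz, rfl⟩
    exact hN' z hz
  have hmul1 (z : ℂ) (hz : z.im ≠ 0) (w : ℂ) (hw : w.im ≠ 0) :
      circleResolvent z hz * circleResolvent w hw ∈ S := by
    have hne (z : ℂ) (hz : z.im ≠ 0) (w : ℂ) (hw : w.im ≠ 0) (hzw : z ≠ w) :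
        circleResolvent z hz * circleResolvent w hw ∈ S := by
      have h1 : circleResolvent z hz * circleResolvent w hw =
          (z - w)⁻¹ • (circleResolvent z hz - circleResolvent w hw) := by
        rw [circleResolvent_sub, smul_smul, inv_mul_cancel₀ (sub_ne_zero.mpr hzw), one_smul]
      rw [h1]
      exact S.smul_mem _ (S.sub_mem (hGS z hz) (hGS w hw))
    by_cases hzw : z = w
    · subst hzw
      -- For a square the resolvent identity degenerates, so one factor is perturbed. Moving `z`
      -- away from the real axis keeps the norms bounded by `|Im z|⁻¹`.
      set a : ℕ → ℂ := fun n => z + ((z.im * (1 / ((n : ℝ) + 1)) : ℝ) : ℂ) * Complex.I with ha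
      have haim (n : ℕ) : (a n).im = z.im * (1 + 1 / ((n : ℝ) + 1)) := by
        simp [ha, -Complex.ofReal_mul]
        ring
      have hpos (n : ℕ) : (0 : ℝ) < 1 / ((n : ℝ) + 1) := Nat.one_div_pos_of_nat
      have haim0 (n : ℕ) : (a n).im ≠ 0 := by
        rw [haim]
        exact mul_ne_zero hz (by linarith [hpos n])
      have haz (n : ℕ) : z ≠ a n := fun h => by
        have := haim n
        rw [← h] at this
        have h2 : z.im * (1 / ((n : ℝ) + 1)) = 0 := by linear_combination -this
        exact (mul_ne_zero hz (hpos n).ne') h2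
      have hlim : Tendsto (fun n => circleResolvent z hz * circleResolvent (a n) (haim0 n)) atTop
          (𝓝 (circleResolvent z hz * circleResolvent z hz)) := by
        rw [tendsto_iff_norm_sub_tendsto_zero]
        have hlim0 : Tendsto (fun n : ℕ => |z.im|⁻¹ * (|z.im| * (1 / ((n : ℝ) + 1)) *
            (|z.im|⁻¹ * |z.im|⁻¹))) atTop (𝓝 0) := by
          have := tendsto_one_div_add_atTop_nhds_zero_nat (𝕜 := ℝ)
          have h3 := ((this.const_mul |z.im|).mul_const (|z.im|⁻¹ * |z.im|⁻¹)).const_mul |z.im|⁻¹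
          simpa using h3
        refine squeeze_zero (fun _ => norm_nonneg _) (fun n => ?_) hlim0
        rw [← mul_sub, circleResolvent_sub]
        have hb1 := norm_circleResolvent_le hz
        have hb2 : ‖circleResolvent (a n) (haim0 n)‖ ≤ |z.im|⁻¹ := by
          refine (norm_circleResolvent_le (haim0 n)).trans (inv_anti₀ (abs_pos.mpr hz) ?_)
          rw [haim, abs_mul, abs_of_pos (by linarith [hpos n] : 0 < 1 + 1 / ((n : ℝ) + 1))]
          have := abs_nonneg z.im
          nlinarith [hpos n]
        have hb3 : ‖a n - z‖ = |z.im| * (1 / ((n : ℝ) + 1)) := by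
          rw [ha]
          simp only [add_sub_cancel_left]
          rw [norm_mul, Complex.norm_I, mul_one, Complex.norm_real, Real.norm_eq_abs, abs_mul,
            abs_of_pos (hpos n)]
        refine (norm_mul_le _ _).trans ?_
        refine mul_le_mul hb1 ?_ (norm_nonneg _) (by positivity)
        rw [norm_smul, hb3]
        refine mul_le_mul_of_nonneg_left ((norm_mul_le _ _).trans ?_) (by positivity)
        exact mul_le_mul hb2 hb1 (norm_nonneg _) (by positivity)
      exact hSc.mem_of_tendsto hlim (Eventually.of_forall fun n => hne _ hz _ (haim0 n) (haz n))
    · exact hne z hz w hw hzw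
  have hmul2 (z : ℂ) (hz : z.im ≠ 0) (y) (hy : y ∈ S) : circleResolvent z hz * y ∈ S :=
    hmin (S.comap (LinearMap.mulLeft ℂ (circleResolvent z hz)))
      (hSc.preimage (continuous_const.mul continuous_id)) (fun w hw => hmul1 z hz w hw) hy
  have hmul3 (x y) (hx : x ∈ S) (hy : y ∈ S) : x * y ∈ S :=
    hmin (S.comap (LinearMap.mulRight ℂ y))
      (hSc.preimage (continuous_id.mul continuous_const)) (fun w hw => hmul2 w hw y hy) hx
  have hall (g : C(resolventCircle, ℂ)₀) : g ∈ S := by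
    induction g using ContinuousMapZero.induction_on_of_compact with
    | zero => exact S.zero_mem
    | id =>
      have hI : Complex.I.im ≠ 0 := by simp
      have h1 : ContinuousMapZero.id resolventCircle = circleResolvent Complex.I hI := by
        ext w
        rw [circleResolvent_apply, sub_self, zero_mul, add_zero, div_one]
        rfl
      rw [h1]
      exact hGS _ _
    | star_id =>
      have hI : (-Complex.I).im ≠ 0 := by simp
      have h1 : star (ContinuousMapZero.id resolventCircle) = circleResolvent (-Complex.I) hI := by
        ext w
        rw [circleResolvent_apply, eq_div_iff
          (one_add_mul_ne_zero_of_mem_resolventCircle hI w.2)]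
        change starRingEnd ℂ (w : ℂ) * (1 + (Complex.I - -Complex.I) * w) = w
        have h2 : starRingEnd ℂ (w : ℂ) * w = ((w : ℂ).im : ℂ) := by
          rw [← Complex.normSq_eq_conj_mul_self]
          exact congrArg _ w.2
        have h3 := Complex.sub_conj (w : ℂ)
        push_cast at h3
        linear_combination (2 * Complex.I) * h2 - h3
      rw [h1]
      exact hGS _ _
    | add f g hf hg => exact S.add_mem hf hg
    | mul f g hf hg => exact hmul3 f g hf hg
    | smul r f hf => exact S.smul_mem r hf
    | frequently f hf => exact hSc.closure_subset (mem_closure_iff_frequently.mpr hf)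
  exact hmin M hM h (hall g)

end Circle

/-! ### The functional calculus of a self-adjoint operator -/

section FunCalc

open scoped ContinuousMapZero

/-- The function `f ∈ C₀(ℝ)` in the coordinate `w = (x - i)⁻¹`. -/
def circleFunction (f : C₀(ℝ, ℝ)) (w : ℂ) : ℂ :=
  if w = 0 then (0 : ℂ) else ((f (w⁻¹ + Complex.I).re : ℝ) : ℂ)

theorem continuousOn_circleFunction (f : C₀(ℝ, ℝ)) :
    ContinuousOn (circleFunction f) resolventCircle := by
  intro w hw
  by_cases h0 : w = 0
  · subst h0
    rw [ContinuousWithinAt, Metric.tendsto_nhdsWithin_nhds]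
    intro ε hε
    have h1 : {x : ℝ | |f x| < ε} ∈ cocompact ℝ := by
      have := (Metric.tendsto_nhds.mp (zero_at_infty f)) ε hε
      simpa [Real.dist_eq] using this
    obtain ⟨r, hr⟩ := (Metric.mem_cocompact_iff_closedBall_compl_subset (0 : ℝ)).mp h1
    -- Here `x = w⁻¹ + i` satisfies `|x| ≥ |w|⁻¹ - 1 > |r| + 1`, which puts `x` outside the ball of
    -- radius `r`.
    refine ⟨(|r| + 2)⁻¹, by positivity, fun {w} hw hwr => ?_⟩
    rw [dist_zero_right] at hwr
    have hzero : circleFunction f 0 = 0 := if_pos rfl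
    rw [hzero, dist_zero_right]
    by_cases hw0 : w = 0
    · rw [hw0, hzero, norm_zero]
      exact hε
    · rw [circleFunction, if_neg hw0, Complex.norm_real, Real.norm_eq_abs]
      have h2 : (w⁻¹ + Complex.I).re ∈ (Metric.closedBall (0 : ℝ) r)ᶜ := by
        rw [Set.mem_compl_iff, mem_closedBall_zero_iff, not_le, Real.norm_eq_abs]
        have h3 : |(w⁻¹ + Complex.I).re| = ‖w⁻¹ + Complex.I‖ := by
          conv_rhs => rw [inv_add_I_of_mem_resolventCircle hw hw0]
          rw [Complex.norm_real, Real.norm_eq_abs]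
        have h4 : |r| + 2 < ‖w⁻¹‖ := by
          rw [norm_inv]
          exact (lt_inv_comm₀ (norm_pos_iff.mpr hw0) (by positivity)).mp hwr
        have h5 := norm_sub_norm_le w⁻¹ (-Complex.I)
        rw [norm_neg, Complex.norm_I, sub_neg_eq_add] at h5
        rw [h3]
        linarith [le_abs_self r]
      exact hr h2
  · have h1 : ContinuousAt (fun w : ℂ => ((f (w⁻¹ + Complex.I).re : ℝ) : ℂ)) w := by
      have h2 : ContinuousAt (fun w : ℂ => (w⁻¹ + Complex.I).re) w :=
        Complex.continuous_re.continuousAt.comp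
          ((continuousAt_inv₀ h0).add continuousAt_const)
      exact Complex.continuous_ofReal.continuousAt.comp (f.continuous.continuousAt.comp h2)
    refine (h1.congr ?_).continuousWithinAt
    filter_upwards [isOpen_ne.mem_nhds h0] with u hu
    exact (if_neg hu).symm

/-- `circleFunction f` as a continuous function on the circle. -/
def circleFunctionMap (f : C₀(ℝ, ℝ)) : C(resolventCircle, ℂ)₀ where
  toFun := resolventCircle.domRestrict (circleFunction f)
  continuous_toFun := (continuousOn_circleFunction f).domRestrict
  map_zero' := if_pos rfl

theorem circleFunctionMap_toCircle (f : C₀(ℝ, ℝ)) (x : ℝ) : circleFunctionMap f (toCircle x) = (f x : ℂ) := by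
  change circleFunction f ((x : ℂ) - Complex.I)⁻¹ = _
  rw [circleFunction, if_neg (inv_ne_zero (ofReal_sub_I_ne_zero x))]
  simp

variable {E : Type*} [NormedAddCommGroup E] [InnerProductSpace ℂ E] [CompleteSpace E]

theorem IsSelfAdjoint.star_resolventAt_I {T : E →ₗ.[ℂ] E} (hT : IsSelfAdjoint T) :
    star (resolventAt T Complex.I) = resolventAt T (-Complex.I) := by
  rw [ContinuousLinearMap.star_eq_adjoint, hT.adjoint_resolventAt (by simp), Complex.conj_I]

theorem IsSelfAdjoint.resolventAt_sub {T : E →ₗ.[ℂ] E} (hT : IsSelfAdjoint T) {z w : ℂ}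
    (hz : z.im ≠ 0) (hw : w.im ≠ 0) :
    resolventAt T z - resolventAt T w = (z - w) • (resolventAt T z * resolventAt T w) :=
  (hT.isResolventAt_resolventAt hz).resolvent_identity (hT.isResolventAt_resolventAt hw)

theorem IsSelfAdjoint.resolventAt_I_sub_star {T : E →ₗ.[ℂ] E} (hT : IsSelfAdjoint T) :
    resolventAt T Complex.I - star (resolventAt T Complex.I) =
      (2 * Complex.I) • (resolventAt T Complex.I * star (resolventAt T Complex.I)) := by
  rw [hT.star_resolventAt_I, hT.resolventAt_sub (by simp) (by simp)]
  congr 1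
  ring

/-- The resolvent identity for the pair `i, -i`, read in both orders, expresses `RR*` and `R*R` by
the same difference. -/
theorem IsSelfAdjoint.isStarNormal_resolventAt_I {T : E →ₗ.[ℂ] E} (hT : IsSelfAdjoint T) :
    IsStarNormal (resolventAt T Complex.I) := by
  refine ⟨?_⟩
  have h1 := hT.resolventAt_I_sub_star
  have h2 := hT.resolventAt_sub (z := -Complex.I) (w := Complex.I) (by simp) (by simp)
  rw [← hT.star_resolventAt_I] at h2
  have h3 : (2 * Complex.I) • (star (resolventAt T Complex.I) * resolventAt T Complex.I) =
      (2 * Complex.I) • (resolventAt T Complex.I * star (resolventAt T Complex.I)) := by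
    rw [← h1, ← neg_sub (star _), h2, ← neg_smul]
    congr 1
    ring
  exact smul_right_injective _ (by simp) h3

/-- The relation `R - R* = 2i RR*` passes through the functional calculus to the quasispectrum,
where it reads `w - conj w = 2i|w|²`, the equation of the circle. -/
theorem IsSelfAdjoint.quasispectrum_resolventAt_I {T : E →ₗ.[ℂ] E} (hT : IsSelfAdjoint T) :
    quasispectrum ℂ (resolventAt T Complex.I) ⊆ resolventCircle := by
  have hn := hT.isStarNormal_resolventAt_I
  intro w hw
  set R := resolventAt T Complex.I with hR
  have h1 : cfcₙ (fun w : ℂ => w - star w - 2 * Complex.I * (w * star w)) R = 0 := by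
    rw [cfcₙ_sub (fun w : ℂ => w - star w) (fun w : ℂ => 2 * Complex.I * (w * star w)) R,
      cfcₙ_sub (fun w : ℂ => w) (fun w : ℂ => star w) R,
      cfcₙ_const_mul (2 * Complex.I) (fun w : ℂ => w * star w) R,
      cfcₙ_mul (fun w : ℂ => w) (fun w : ℂ => star w) R, cfcₙ_id' ℂ R, cfcₙ_star_id R,
      hT.resolventAt_I_sub_star, sub_self]
  have h2 := cfcₙ_map_quasispectrum (R := ℂ)
    (fun w : ℂ => w - star w - 2 * Complex.I * (w * star w)) R
  rw [h1, CFC.quasispectrum_zero_eq] at h2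
  have h3 : w - star w - 2 * Complex.I * (w * star w) = 0 := by
    have : w - star w - 2 * Complex.I * (w * star w) ∈ ({0} : Set ℂ) := by
      rw [h2]
      exact ⟨w, hw, rfl⟩
    exact this
  have h4 := congrArg Complex.im h3
  simp only [Complex.star_def, Complex.mul_conj] at h4
  change Complex.normSq w = w.im
  simp at h4
  linarith

/-- The functional calculus of `T` on continuous functions on the circle. -/
def circleCalc (T : E →ₗ.[ℂ] E) (hT : IsSelfAdjoint T) :
    C(resolventCircle, ℂ)₀ →⋆ₙₐ[ℂ] (E →L[ℂ] E) :=
  cfcₙHomSuperset hT.isStarNormal_resolventAt_I hT.quasispectrum_resolventAt_I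

theorem funCalc_eq_circleCalc {T : E →ₗ.[ℂ] E} (hT : IsSelfAdjoint T) (f : C₀(ℝ, ℝ)) :
    funCalc T f = circleCalc T hT (circleFunctionMap f) := by
  have hn := hT.isStarNormal_resolventAt_I
  have hc : ContinuousOn (circleFunction f) (quasispectrum ℂ (resolventAt T Complex.I)) :=
    (continuousOn_circleFunction f).mono hT.quasispectrum_resolventAt_I
  have h0 : circleFunction f 0 = 0 := if_pos rfl
  change cfc (circleFunction f) (resolventAt T Complex.I) = _
  rw [← cfcₙ_eq_cfc hc h0, cfcₙ_apply (circleFunction f) (resolventAt T Complex.I) hc h0 hn]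
  rfl

theorem norm_circleCalc_le {T : E →ₗ.[ℂ] E} (hT : IsSelfAdjoint T)
    (g : C(resolventCircle, ℂ)₀) : ‖circleCalc T hT g‖ ≤ ‖g‖ := by
  rw [circleCalc, cfcₙHomSuperset_apply, norm_cfcₙHom _ _ hT.isStarNormal_resolventAt_I,
    ContinuousMapZero.norm_def, ContinuousMap.norm_le _ (norm_nonneg _)]
  intro w
  exact ContinuousMap.norm_coe_le_norm (g : C(resolventCircle, ℂ)) _

/-- Both sides solve `X - R = (z - i) X R` with `R` the resolvent at `i`. The solution is unique
because `1 - (z - i)R` has the right inverse `1 + (z - i)S`, where `S` is the resolvent at `z`. -/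
theorem circleCalc_circleResolvent {T : E →ₗ.[ℂ] E} (hT : IsSelfAdjoint T) {z : ℂ}
    (hz : z.im ≠ 0) : circleCalc T hT (circleResolvent z hz) = resolventAt T z := by
  have hI : Complex.I.im ≠ 0 := by simp
  set R := resolventAt T Complex.I with hR
  set Q := circleCalc T hT (circleResolvent z hz) with hQ
  have hid : circleCalc T hT (circleResolvent Complex.I hI) = R := by
    have h1 : circleResolvent Complex.I hI = ContinuousMapZero.id resolventCircle := by
      ext w
      rw [circleResolvent_apply, sub_self, zero_mul, add_zero, div_one]
      rfl
    rw [h1]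
    exact cfcₙHomSuperset_id hT.isStarNormal_resolventAt_I hT.quasispectrum_resolventAt_I
  have h1 : Q - R = (z - Complex.I) • (Q * R) := by
    rw [← hid, hQ, ← map_sub, circleResolvent_sub, map_smul, map_mul]
  have h2 := hT.resolventAt_sub hz hI
  have h3 := hT.resolventAt_sub hI hz
  rw [← hR] at h2 h3
  set S := resolventAt T z with hS
  have h4 : Q - S = (z - Complex.I) • ((Q - S) * R) := by
    rw [sub_mul, smul_sub, ← h1, ← h2]
    abel
  have h5 : (Q - S) * (1 - (z - Complex.I) • R) = 0 := by
    rw [mul_sub, mul_one, mul_smul_comm, ← h4, sub_self]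
  have h6 : (1 - (z - Complex.I) • R) * (1 + (z - Complex.I) • S) = 1 := by
    have h7 : (z - Complex.I) • R * ((z - Complex.I) • S) =
        (z - Complex.I) • (S - R) := by
      rw [smul_mul_smul_comm, mul_smul, ← neg_sub R S, h3, ← neg_smul, neg_sub]
    rw [sub_mul, one_mul, mul_add, mul_one, h7, smul_sub]
    abel
  have h8 : Q - S = (Q - S) * ((1 - (z - Complex.I) • R) * (1 + (z - Complex.I) • S)) := by
    rw [h6, mul_one]
  rw [← mul_assoc, h5, zero_mul] at h8
  exact sub_eq_zero.mp h8

end FunCalc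

/-! ### The density of states measure of the Lloyd model -/

section LloydMeasure

open scoped ContinuousMapZero

/-- The law of the sum of the symbol of the Laplacian at a uniform point of the torus and an
independent Cauchy variable. -/
def lloydDOS (d : ℕ) (γ : ℝ≥0) : Measure ℝ :=
  ((torusMeasure d).prod (cauchyMeasure 0 γ)).map fun q => latticeSymbol q.1 + q.2

theorem measurable_latticeSymbol_add (d : ℕ) :
    Measurable fun q : (Fin d → ℝ) × ℝ => latticeSymbol q.1 + q.2 := by fun_prop

instance (d : ℕ) (γ : ℝ≥0) : IsProbabilityMeasure (lloydDOS d γ) :=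
  Measure.isProbabilityMeasure_map (measurable_latticeSymbol_add d).aemeasurable

theorem integral_lloydDOS {d : ℕ} {γ : ℝ≥0} {F : Type*} [NormedAddCommGroup F] [NormedSpace ℝ F]
    {f : ℝ → F} (hf : Integrable f (lloydDOS d γ)) :
    ∫ x, f x ∂(lloydDOS d γ) =
      ∫ u, ∫ y, f (latticeSymbol u + y) ∂(cauchyMeasure 0 γ) ∂(torusMeasure d) := by
  rw [lloydDOS, integral_map (measurable_latticeSymbol_add d).aemeasurable hf.aestronglyMeasurable,
    integral_prod]
  exact (integrable_map_measure hf.aestronglyMeasurable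
    (measurable_latticeSymbol_add d).aemeasurable).mp hf

/-- The Cauchy average again shifts the spectral parameter by `iγ`; the right side is that of
`integral_inner_resolventAt`. -/
theorem integral_inv_sub_lloydDOS (d : ℕ) (γ : ℝ≥0) {z : ℂ} (hz : 0 < z.im) :
    ∫ x, ((x : ℂ) - z)⁻¹ ∂(lloydDOS d γ) =
      ∫ u, ((latticeSymbol u : ℂ) - (z + γ * Complex.I))⁻¹ ∂(torusMeasure d) := by
  rw [integral_lloydDOS (integrable_inv_sub_of_im_pos hz)]
  refine integral_congr_ae (Eventually.of_forall fun u => ?_)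
  have h := integral_inv_sub_cauchyMeasure γ (w := z - latticeSymbol u) (by simpa using hz)
  dsimp only
  have h1 (y : ℝ) : (((latticeSymbol u + y : ℝ) : ℂ) - z)⁻¹ =
      ((y : ℂ) - (z - latticeSymbol u))⁻¹ := by
    push_cast
    ring_nf
  simp_rw [h1]
  rw [h]
  ring_nf

variable {d : ℕ}

/-- The diagonal matrix element at the origin of a function of the Hamiltonian. -/
def siteElement (g : C(resolventCircle, ℂ)₀) (ω : LatticeSite d → ℝ) : ℂ :=
  ⟪siteVector (0 : LatticeSite d),
    circleCalc (anderson ω) (isSelfAdjoint_anderson ω) g (siteVector 0)⟫_ℂ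

theorem norm_siteElement_le (g : C(resolventCircle, ℂ)₀) (ω : LatticeSite d → ℝ) :
    ‖siteElement g ω‖ ≤ ‖g‖ := by
  have h1 := norm_inner_le_norm (𝕜 := ℂ) (siteVector (0 : LatticeSite d))
    (circleCalc (anderson ω) (isSelfAdjoint_anderson ω) g (siteVector 0))
  have h2 := ContinuousLinearMap.le_opNorm (circleCalc (anderson ω) (isSelfAdjoint_anderson ω) g)
    (siteVector (0 : LatticeSite d))
  rw [norm_siteVector, one_mul] at h1
  rw [norm_siteVector, mul_one] at h2
  exact h1.trans (h2.trans (norm_circleCalc_le _ g))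

theorem siteElement_add (g h : C(resolventCircle, ℂ)₀) (ω : LatticeSite d → ℝ) :
    siteElement (g + h) ω = siteElement g ω + siteElement h ω := by
  rw [siteElement, map_add, add_apply, inner_add_right]
  rfl

theorem siteElement_smul (c : ℂ) (g : C(resolventCircle, ℂ)₀) (ω : LatticeSite d → ℝ) :
    siteElement (c • g) ω = c * siteElement g ω := by
  rw [siteElement, map_smul, smul_apply, inner_smul_right]
  rfl

theorem continuous_siteElement (ω : LatticeSite d → ℝ) :
    Continuous fun g => siteElement (d := d) g ω := by
  have h : Continuous (circleCalc (anderson ω) (isSelfAdjoint_anderson ω)) :=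
    cfcₙHomSuperset_continuous _ _
  exact continuous_const.inner (h.clm_apply continuous_const)

theorem integrable_circle_comp (γ : ℝ≥0) (g : C(resolventCircle, ℂ)₀) :
    Integrable (fun x => g (toCircle x)) (lloydDOS d γ) := by
  refine Integrable.of_bound (C := ‖g‖)
    (g.continuous.comp continuous_toCircle).aestronglyMeasurable (Eventually.of_forall fun x => ?_)
  exact ContinuousMap.norm_coe_le_norm (g : C(resolventCircle, ℂ)) _

theorem siteElement_circleResolvent {z : ℂ} (hz : z.im ≠ 0) (ω : LatticeSite d → ℝ) :
    siteElement (circleResolvent z hz) ω =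
      ⟪siteVector (0 : LatticeSite d), resolventAt (anderson ω) z (siteVector 0)⟫_ℂ := by
  rw [siteElement, circleCalc_circleResolvent]

theorem integrable_siteElement {γ : ℝ≥0} {g : C(resolventCircle, ℂ)₀}
    (hg : Measurable (siteElement (d := d) g)) :
    Integrable (siteElement g)
      (Measure.infinitePi fun _ : LatticeSite d => cauchyMeasure 0 γ) :=
  Integrable.of_bound (C := ‖g‖) hg.aestronglyMeasurable
    (Eventually.of_forall (norm_siteElement_le g))

theorem siteElement_circleResolvent_conj {z : ℂ} (hz : z.im ≠ 0)
    (hz' : (starRingEnd ℂ z).im ≠ 0) (ω : LatticeSite d → ℝ) :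
    siteElement (circleResolvent z hz) ω =
      starRingEnd ℂ (siteElement (circleResolvent (starRingEnd ℂ z) hz') ω) := by
  rw [siteElement_circleResolvent, siteElement_circleResolvent,
    ← (isSelfAdjoint_anderson ω).adjoint_resolventAt hz, inner_conj_symm,
    ContinuousLinearMap.adjoint_inner_left]

/-- The averaged functional calculus of the Lloyd model is integration against `lloydDOS`. -/
theorem measurable_and_integral_siteElement (γ : ℝ≥0) (g : C(resolventCircle, ℂ)₀) :
    Measurable (siteElement (d := d) g) ∧
      ∫ ω, siteElement g ω ∂(Measure.infinitePi fun _ : LatticeSite d => cauchyMeasure 0 γ) =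
        ∫ x, g (toCircle x) ∂(lloydDOS d γ) := by
  -- The functions with both properties form a closed subspace, so it is enough to check the
  -- resolvents. Measurability is carried along because it is needed to integrate sums and limits.
  let M : Submodule ℂ C(resolventCircle, ℂ)₀ :=
    { carrier := {g | Measurable (siteElement (d := d) g) ∧
        ∫ ω, siteElement g ω ∂(Measure.infinitePi fun _ : LatticeSite d => cauchyMeasure 0 γ) =
          ∫ x, g (toCircle x) ∂(lloydDOS d γ)}
      zero_mem' := by
        have h (ω : LatticeSite d → ℝ) : siteElement (0 : C(resolventCircle, ℂ)₀) ω = 0 := by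
          rw [siteElement, map_zero, zero_apply, inner_zero_right]
        refine ⟨?_, ?_⟩
        · rw [show siteElement (d := d) (0 : C(resolventCircle, ℂ)₀) = fun _ => 0 from funext h]
          exact measurable_const
        · simp [h]
      add_mem' := by
        rintro g h ⟨hg1, hg2⟩ ⟨hh1, hh2⟩
        have hadd : siteElement (d := d) (g + h) = fun ω => siteElement g ω + siteElement h ω :=
          funext (siteElement_add g h)
        refine ⟨?_, ?_⟩
        · rw [hadd]
          exact hg1.add hh1
        · rw [hadd, integral_add (integrable_siteElement hg1) (integrable_siteElement hh1), hg2, hh2,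
            ← integral_add (integrable_circle_comp γ g) (integrable_circle_comp γ h)]
          rfl
      smul_mem' := by
        rintro c g ⟨hg1, hg2⟩
        have hsmul : siteElement (d := d) (c • g) = fun ω => c * siteElement g ω :=
          funext (siteElement_smul c g)
        refine ⟨?_, ?_⟩
        · rw [hsmul]
          exact hg1.const_mul c
        · rw [hsmul, integral_const_mul, hg2, ← integral_const_mul]
          rfl }
  have hMc : IsClosed (M : Set C(resolventCircle, ℂ)₀) := by
    refine isClosed_of_closure_subset fun g hg => ?_
    obtain ⟨a, ha, hag⟩ := mem_closure_iff_seq_limit.mp hg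
    have hpt (ω : LatticeSite d → ℝ) :
        Tendsto (fun n => siteElement (a n) ω) atTop (𝓝 (siteElement g ω)) :=
      ((continuous_siteElement ω).tendsto g).comp hag
    have hmeas : Measurable (siteElement (d := d) g) :=
      measurable_of_tendsto_metrizable (fun n => (ha n).1) (tendsto_pi_nhds.mpr hpt)
    refine ⟨hmeas, ?_⟩
    obtain ⟨B, hB⟩ : ∃ B, ∀ n, ‖a n‖ ≤ B := by
      obtain ⟨B, hB⟩ := (hag.norm).bddAbove_range
      exact ⟨B, fun n => hB ⟨n, rfl⟩⟩
    have h1 : Tendsto (fun n => ∫ ω, siteElement (a n) ω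
        ∂(Measure.infinitePi fun _ : LatticeSite d => cauchyMeasure 0 γ)) atTop
        (𝓝 (∫ ω, siteElement g ω
          ∂(Measure.infinitePi fun _ : LatticeSite d => cauchyMeasure 0 γ))) :=
      tendsto_integral_of_dominated_convergence (fun _ => B)
        (fun n => (ha n).1.aestronglyMeasurable) (integrable_const _)
        (fun n => Eventually.of_forall fun ω => (norm_siteElement_le _ ω).trans (hB n))
        (Eventually.of_forall hpt)
    have h2 : Tendsto (fun n => ∫ x, a n (toCircle x) ∂(lloydDOS d γ)) atTop
        (𝓝 (∫ x, g (toCircle x) ∂(lloydDOS d γ))) :=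
      tendsto_integral_of_dominated_convergence (fun _ => B)
        (fun n => (integrable_circle_comp γ (a n)).aestronglyMeasurable) (integrable_const _)
        (fun n => Eventually.of_forall fun x =>
          (ContinuousMap.norm_coe_le_norm (a n : C(resolventCircle, ℂ)) _).trans (hB n))
        (Eventually.of_forall fun x =>
          ((continuous_eval_const (F := C(resolventCircle, ℂ)₀) (toCircle x)).tendsto g).comp hag)
    exact tendsto_nhds_unique h1 (h2.congr fun n => ((ha n).2).symm)
  have hpos (z : ℂ) (hz : 0 < z.im) (hz' : z.im ≠ 0) : circleResolvent z hz' ∈ M := by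
    have h1 : siteElement (d := d) (circleResolvent z hz') = fun ω =>
        ⟪siteVector (0 : LatticeSite d), resolventAt (anderson ω) z (siteVector 0)⟫_ℂ :=
      funext (siteElement_circleResolvent hz')
    refine ⟨?_, ?_⟩
    · rw [h1]
      exact measurable_inner_resolventAt hz _
    · rw [h1, integral_inner_resolventAt γ hz, ← integral_inv_sub_lloydDOS d γ hz]
      simp_rw [circleResolvent_toCircle]
  refine circleResolvent_mem_submodule_eq_top M hMc (fun z hz => ?_) g
  -- The averaging was done in the upper half plane only; the lower half plane follows by complex
  -- conjugation.
  rcases lt_or_gt_of_ne hz with hneg | hz0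
  · have hz' : (starRingEnd ℂ z).im ≠ 0 := by simpa using hz
    obtain ⟨h1, h2⟩ := hpos (starRingEnd ℂ z) (by simpa using hneg) hz'
    have h3 : siteElement (d := d) (circleResolvent z hz) = fun ω =>
        starRingEnd ℂ (siteElement (circleResolvent (starRingEnd ℂ z) hz') ω) :=
      funext (siteElement_circleResolvent_conj hz hz')
    refine ⟨?_, ?_⟩
    · rw [h3]
      exact Complex.continuous_conj.measurable.comp h1
    · rw [h3, integral_conj, h2, ← integral_conj]
      simp_rw [circleResolvent_toCircle, map_inv₀, map_sub, Complex.conj_conj, Complex.conj_ofReal]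
  · exact hpos z hz0 hz

theorem siteTrace_eq (f : C₀(ℝ, ℝ)) (ω : LatticeSite d → ℝ) :
    siteTrace f ω = (siteElement (circleFunctionMap f) ω).re := by
  rw [siteTrace, funCalc_eq_circleCalc (isSelfAdjoint_anderson ω)]
  rfl

theorem isDOSMeasure_lloydDOS (d : ℕ) (γ : ℝ≥0) : IsDOSMeasure d (lloydLaw γ) (lloydDOS d γ) := by
  refine ⟨inferInstance, fun f => ?_⟩
  obtain ⟨h1, h2⟩ := measurable_and_integral_siteElement (d := d) γ (circleFunctionMap f)
  have h3 := integrable_siteElement (γ := γ) h1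
  have h4 : siteTrace (d := d) f = fun ω => (siteElement (circleFunctionMap f) ω).re :=
    funext (siteTrace_eq f)
  rw [h4]
  refine ⟨h3.re, ?_⟩
  have h5 := congrArg Complex.re h2
  have h6 := integral_re h3
  have h7 := integral_re (integrable_circle_comp (d := d) γ (circleFunctionMap f))
  simp only [RCLike.re_to_complex] at h6 h7
  rw [h6, h5, ← h7]
  simp_rw [circleFunctionMap_toCircle, Complex.ofReal_re]

/-- Compactly supported functions belong to `C₀(ℝ)` and determine a finite measure. -/
theorem IsDOSMeasure.unique {ν : Measure ℝ} [IsProbabilityMeasure ν] {m n : Measure ℝ}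
    (hm : IsDOSMeasure d ν m) (hn : IsDOSMeasure d ν n) : m = n := by
  have := hm.1
  have := hn.1
  refine Measure.ext_of_integral_eq_on_compactlySupported fun f => ?_
  have h1 := (hm.2 ⟨f, zero_at_infty f⟩).2
  have h2 := (hn.2 ⟨f, zero_at_infty f⟩).2
  exact h1.trans h2.symm

end LloydMeasure

/-! ### The Bessel function `J₀` -/

section Bessel

theorem hasDerivAt_intervalIntegral_of_bound {F F' : ℝ → ℝ → ℝ} {C : ℝ}
    (hF : ∀ s, Continuous (F s)) (hF' : ∀ s, Continuous (F' s))
    (hd : ∀ s u, HasDerivAt (fun s => F s u) (F' s u) s) (hC : ∀ s u, |F' s u| ≤ C) (s : ℝ) :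
    HasDerivAt (fun s => ∫ u in (0 : ℝ)..1, F s u) (∫ u in (0 : ℝ)..1, F' s u) s :=
  (intervalIntegral.hasDerivAt_integral_of_dominated_loc_of_deriv_le (F := F) (F' := F')
    (bound := fun _ => C) univ_mem
    (Eventually.of_forall fun s => (hF s).aestronglyMeasurable)
    ((hF s).intervalIntegrable _ _) (hF' s).aestronglyMeasurable
    (Eventually.of_forall fun u _ s _ => hC s u) intervalIntegrable_const
    (Eventually.of_forall fun u _ s _ => hd s u)).2

/-- The Bessel function `J₀`. -/
def besselJ (s : ℝ) : ℝ := ∫ u in (0 : ℝ)..1, Real.cos (s * Real.cos (2 * Real.pi * u))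

/-- The derivative of `J₀`. -/
def besselJDeriv (s : ℝ) : ℝ :=
  ∫ u in (0 : ℝ)..1, -(Real.cos (2 * Real.pi * u) * Real.sin (s * Real.cos (2 * Real.pi * u)))

theorem hasDerivAt_besselJ (s : ℝ) : HasDerivAt besselJ (besselJDeriv s) s := by
  refine hasDerivAt_intervalIntegral_of_bound (C := 1)
    (F := fun s u => Real.cos (s * Real.cos (2 * Real.pi * u)))
    (F' := fun s u => -(Real.cos (2 * Real.pi * u) * Real.sin (s * Real.cos (2 * Real.pi * u))))
    (fun s => by fun_prop) (fun s => by fun_prop) (fun s u => ?_) (fun s u => ?_) s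
  · refine (hasDerivAt_mul_const (Real.cos (2 * Real.pi * u))).cos.congr_deriv ?_
    ring
  · rw [abs_neg, abs_mul]
    exact mul_le_one₀ (Real.abs_cos_le_one _) (abs_nonneg _) (Real.abs_sin_le_one _)

theorem hasDerivAt_besselJDeriv (s : ℝ) : HasDerivAt besselJDeriv
    (∫ u in (0 : ℝ)..1, -(Real.cos (2 * Real.pi * u) ^ 2 *
      Real.cos (s * Real.cos (2 * Real.pi * u)))) s := by
  refine hasDerivAt_intervalIntegral_of_bound (C := 1)
    (F := fun s u => -(Real.cos (2 * Real.pi * u) * Real.sin (s * Real.cos (2 * Real.pi * u))))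
    (F' := fun s u => -(Real.cos (2 * Real.pi * u) ^ 2 *
      Real.cos (s * Real.cos (2 * Real.pi * u))))
    (fun s => by fun_prop) (fun s => by fun_prop) (fun s u => ?_) (fun s u => ?_) s
  · refine ((hasDerivAt_mul_const (Real.cos (2 * Real.pi * u))).sin.const_mul
      (Real.cos (2 * Real.pi * u))).neg.congr_deriv ?_
    ring
  · rw [abs_neg, abs_mul, abs_pow]
    exact mul_le_one₀ (pow_le_one₀ (abs_nonneg _) (Real.abs_cos_le_one _)) (abs_nonneg _)
      (Real.abs_cos_le_one _)

/-- Bessel's differential equation. -/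
theorem besselJ_ode (s : ℝ) :
    s * (∫ u in (0 : ℝ)..1, -(Real.cos (2 * Real.pi * u) ^ 2 *
      Real.cos (s * Real.cos (2 * Real.pi * u)))) + besselJDeriv s + s * besselJ s = 0 := by
  -- The integrand of `s J₀'' + J₀' + s J₀` is an exact derivative in `u`, of a function that
  -- vanishes at both endpoints.
  have h1 : ∀ u ∈ Set.uIcc (0 : ℝ) 1, HasDerivAt (fun u : ℝ => -(Real.sin (2 * Real.pi * u) *
      Real.sin (s * Real.cos (2 * Real.pi * u))) / (2 * Real.pi))
      (s * -(Real.cos (2 * Real.pi * u) ^ 2 * Real.cos (s * Real.cos (2 * Real.pi * u))) +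
        -(Real.cos (2 * Real.pi * u) * Real.sin (s * Real.cos (2 * Real.pi * u))) +
        s * Real.cos (s * Real.cos (2 * Real.pi * u))) u := by
    intro u _
    have hlin : HasDerivAt (fun u : ℝ => 2 * Real.pi * u) (2 * Real.pi) u := by
      simpa using (hasDerivAt_id u).const_mul (2 * Real.pi)
    refine (((hlin.sin.mul ((hlin.cos.const_mul s).sin)).neg).div_const
      (2 * Real.pi)).congr_deriv ?_
    rw [Real.cos_sq' (2 * Real.pi * u)]
    have := Real.pi_ne_zero
    field_simp
    ring
  have h2 := intervalIntegral.integral_eq_sub_of_hasDerivAt h1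
    (Continuous.intervalIntegrable (by fun_prop) _ _)
  rw [intervalIntegral.integral_add (Continuous.intervalIntegrable (by fun_prop) _ _)
      (Continuous.intervalIntegrable (by fun_prop) _ _),
    intervalIntegral.integral_add (Continuous.intervalIntegrable (by fun_prop) _ _)
      (Continuous.intervalIntegrable (by fun_prop) _ _),
    intervalIntegral.integral_const_mul, intervalIntegral.integral_const_mul] at h2
  rw [besselJ, besselJDeriv, h2]
  simp

theorem abs_besselJ_le_one (s : ℝ) : |besselJ s| ≤ 1 := by
  have := intervalIntegral.norm_integral_le_of_norm_le_const (a := 0) (b := 1) (C := 1)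
    (f := fun u => Real.cos (s * Real.cos (2 * Real.pi * u))) fun u _ => Real.abs_cos_le_one _
  simpa [besselJ] using this

theorem besselJ_neg (s : ℝ) : besselJ (-s) = besselJ s := by
  simp only [besselJ, neg_mul, Real.cos_neg]

theorem continuous_besselJ : Continuous besselJ :=
  continuous_iff_continuousAt.mpr fun s => (hasDerivAt_besselJ s).continuousAt

theorem integral_cos_sq_two_pi : ∫ u in (0 : ℝ)..1, Real.cos (2 * Real.pi * u) ^ 2 = 1 / 2 := by
  have h : (2 * Real.pi) ≠ 0 := by positivity
  rw [intervalIntegral.integral_comp_mul_left (fun x => Real.cos x ^ 2) h, integral_cos_sq]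
  simp only [mul_one, mul_zero, Real.sin_two_pi, Real.sin_zero, smul_eq_mul]
  field_simp
  ring

/-- From `cos c ≤ 1 - c²/2 + 5c⁴/96 ≤ 1 - (43/96)c²` for `|c| ≤ 1`, and the mean `1/2` of the
squared cosine. -/
theorem besselJ_one_le : besselJ 1 ≤ 149 / 192 := by
  have h1 : besselJ 1 ≤ ∫ u in (0 : ℝ)..1, (1 - 43 / 96 * Real.cos (2 * Real.pi * u) ^ 2) := by
    refine intervalIntegral.integral_mono_on zero_le_one
      (Continuous.intervalIntegrable (by fun_prop) _ _)
      (Continuous.intervalIntegrable (by fun_prop) _ _) fun u _ => ?_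
    rw [one_mul]
    set c := Real.cos (2 * Real.pi * u)
    have hc : |c| ≤ 1 := Real.abs_cos_le_one _
    have h2 := (abs_le.mp (Real.cos_bound hc)).2
    have h3 : |c| ^ 2 ≤ 1 := pow_le_one₀ (abs_nonneg _) hc
    have h4 : |c| ^ 4 ≤ c ^ 2 := by
      rw [← sq_abs c]
      nlinarith [sq_nonneg |c|]
    linarith
  refine h1.trans (le_of_eq ?_)
  rw [intervalIntegral.integral_sub intervalIntegrable_const
    (Continuous.intervalIntegrable (by fun_prop) _ _), intervalIntegral.integral_const_mul,
    integral_cos_sq_two_pi]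
  norm_num

theorem le_besselJ_one : 3 / 4 ≤ besselJ 1 := by
  have h1 : ∫ u in (0 : ℝ)..1, (1 - 1 / 2 * Real.cos (2 * Real.pi * u) ^ 2) ≤ besselJ 1 := by
    refine intervalIntegral.integral_mono_on zero_le_one
      (Continuous.intervalIntegrable (by fun_prop) _ _)
      (Continuous.intervalIntegrable (by fun_prop) _ _) fun u _ => ?_
    rw [one_mul]
    have := Real.one_sub_sq_div_two_le_cos (x := Real.cos (2 * Real.pi * u))
    linarith
  refine le_trans (le_of_eq ?_) h1
  rw [intervalIntegral.integral_sub intervalIntegrable_const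
    (Continuous.intervalIntegrable (by fun_prop) _ _), intervalIntegral.integral_const_mul,
    integral_cos_sq_two_pi]
  norm_num

theorem mul_sin_mem {c : ℝ} (hc : |c| ≤ 1) : 0 ≤ c * Real.sin c ∧ c * Real.sin c ≤ c ^ 2 := by
  have hpi := Real.pi_gt_three
  obtain ⟨h1, h2⟩ := abs_le.mp hc
  rcases le_total 0 c with h | h
  · have h3 := Real.sin_nonneg_of_nonneg_of_le_pi h (by linarith)
    have h4 := Real.sin_le h
    exact ⟨mul_nonneg h h3, by nlinarith⟩
  · have h3 := Real.sin_nonpos_of_nonpos_of_neg_pi_le h (by linarith)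
    have h4 := Real.le_sin h
    exact ⟨mul_nonneg_of_nonpos_of_nonpos h h3, by nlinarith⟩

theorem besselJDeriv_one_mem : -(1 / 2) ≤ besselJDeriv 1 ∧ besselJDeriv 1 ≤ 0 := by
  have hmem (u : ℝ) := mul_sin_mem (Real.abs_cos_le_one (2 * Real.pi * u))
  constructor
  · have h1 : ∫ u in (0 : ℝ)..1, -(Real.cos (2 * Real.pi * u) ^ 2) ≤ besselJDeriv 1 := by
      refine intervalIntegral.integral_mono_on zero_le_one
        (Continuous.intervalIntegrable (by fun_prop) _ _)
        (Continuous.intervalIntegrable (by fun_prop) _ _) fun u _ => ?_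
      rw [one_mul]
      exact neg_le_neg (hmem u).2
    rwa [intervalIntegral.integral_neg, integral_cos_sq_two_pi] at h1
  · rw [besselJDeriv, intervalIntegral.integral_neg, neg_nonpos]
    refine intervalIntegral.integral_nonneg zero_le_one fun u _ => ?_
    rw [one_mul]
    exact (hmem u).1

/-- An energy for Bessel's equation. -/
def besselEnergy (s : ℝ) : ℝ :=
  besselJ s ^ 2 / (2 * s) + besselJ s * besselJDeriv s + s * besselJDeriv s ^ 2 + s * besselJ s ^ 2

/-- The function `v = √s J₀` solves `v'' + (1 + 1/(4s²))v = 0`, and the energy is `v'² + (1 +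
1/(4s²))v²`. Only the coefficient contributes to its derivative, and it decreases. -/
theorem hasDerivAt_besselEnergy {s : ℝ} (hs : 0 < s) :
    HasDerivAt besselEnergy (-(besselJ s ^ 2 / (2 * s ^ 2))) s := by
  have h1 := hasDerivAt_besselJ s
  have h2 := hasDerivAt_besselJDeriv s
  have h3 := besselJ_ode s
  set J2 := ∫ u in (0 : ℝ)..1, -(Real.cos (2 * Real.pi * u) ^ 2 *
    Real.cos (s * Real.cos (2 * Real.pi * u))) with hJ2
  have hid := hasDerivAt_id s
  have h4 := ((((h1.pow 2).div (hid.const_mul 2) (by simpa using hs.ne')).add (h1.mul h2)).add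
    (hid.mul (h2.pow 2))).add (hid.mul (h1.pow 2))
  refine h4.congr_deriv ?_
  have h5 : J2 = -(besselJDeriv s + s * besselJ s) / s := by
    field_simp
    linear_combination h3
  simp only [id, Pi.pow_apply]
  rw [h5]
  field_simp
  ring

theorem besselEnergy_le {s : ℝ} (hs : 1 ≤ s) : besselEnergy s ≤ besselEnergy 1 := by
  have hanti : AntitoneOn besselEnergy (Set.Ici 1) := by
    refine antitoneOn_of_deriv_nonpos (convex_Ici 1) ?_ ?_ ?_
    · exact fun x hx => (hasDerivAt_besselEnergy
        (zero_lt_one.trans_le hx)).continuousAt.continuousWithinAt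
    · intro x hx
      rw [interior_Ici] at hx
      exact (hasDerivAt_besselEnergy
        (zero_lt_one.trans hx)).differentiableAt.differentiableWithinAt
    · intro x hx
      rw [interior_Ici] at hx
      rw [(hasDerivAt_besselEnergy (zero_lt_one.trans hx)).deriv]
      exact neg_nonpos.mpr (by positivity)
  exact hanti (Set.self_mem_Ici) hs hs

/-- At `s = 1` the energy is `(3/2)J² + J'(J + J')`. The last product is nonpositive since `-1/2 ≤
J' ≤ 0` and `J ≥ 3/4`, and `(3/2)(149/192)² < 1`. -/
theorem besselEnergy_one_le : besselEnergy 1 ≤ 1 := by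
  have h1 := besselJ_one_le
  have h2 := le_besselJ_one
  obtain ⟨h3, h4⟩ := besselJDeriv_one_mem
  rw [besselEnergy]
  nlinarith

/-- The bound `|J₀(s)| ≤ s^(-1/2)`. -/
theorem besselJ_sq_le {s : ℝ} (hs : 0 < s) : besselJ s ^ 2 ≤ s⁻¹ := by
  rcases le_total s 1 with h | h
  · have h1 : besselJ s ^ 2 ≤ 1 := by
      rw [← sq_abs]
      exact pow_le_one₀ (abs_nonneg _) (abs_besselJ_le_one s)
    exact h1.trans ((one_le_inv₀ hs).mpr h)
  · have h1 := (besselEnergy_le h).trans besselEnergy_one_le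
    -- Completing the square shows that the energy dominates `s J₀(s)²`.
    have h2 : besselEnergy s = s * (besselJDeriv s + besselJ s / (2 * s)) ^ 2 +
        besselJ s ^ 2 / (4 * s) + s * besselJ s ^ 2 := by
      rw [besselEnergy]
      field_simp
      ring
    have h3 : 0 ≤ s * (besselJDeriv s + besselJ s / (2 * s)) ^ 2 := by positivity
    have h4 : 0 ≤ besselJ s ^ 2 / (4 * s) := by positivity
    rw [← one_div, le_div_iff₀ hs]
    linarith

theorem integral_exp_mul_cos (s : ℝ) :
    ∫ u in Set.Ioc (0 : ℝ) 1, Complex.exp (s * Real.cos (2 * Real.pi * u) * Complex.I) =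
      besselJ s := by
  have hcont : Continuous fun u : ℝ => Real.sin (s * Real.cos (2 * Real.pi * u)) := by fun_prop
  -- Shifting `u` by half a period reverses the sign of the integrand.
  have hsin : ∫ u in (0 : ℝ)..1, Real.sin (s * Real.cos (2 * Real.pi * u)) = 0 := by
    have hper : Function.Periodic (fun u : ℝ => Real.sin (s * Real.cos (2 * Real.pi * u))) 1 := by
      intro u
      dsimp only
      rw [mul_add, mul_one, Real.cos_add_two_pi]
    have h1 := hper.intervalIntegral_add_eq 0 (1 / 2)
    have h2 := intervalIntegral.integral_comp_add_right
      (fun u : ℝ => Real.sin (s * Real.cos (2 * Real.pi * u))) (a := 0) (b := 1) (1 / 2)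
    have h3 (u : ℝ) : Real.sin (s * Real.cos (2 * Real.pi * (u + 1 / 2))) =
        -Real.sin (s * Real.cos (2 * Real.pi * u)) := by
      have : 2 * Real.pi * (u + 1 / 2) = 2 * Real.pi * u + Real.pi := by ring
      rw [this, Real.cos_add_pi, mul_neg, Real.sin_neg]
    simp_rw [h3] at h2
    rw [intervalIntegral.integral_neg] at h2
    rw [zero_add] at h1 h2
    rw [add_comm (1 : ℝ)] at h2
    linarith
  rw [← intervalIntegral.integral_of_le zero_le_one]
  have h4 (u : ℝ) : Complex.exp (s * Real.cos (2 * Real.pi * u) * Complex.I) =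
      ((Real.cos (s * Real.cos (2 * Real.pi * u)) : ℝ) : ℂ) +
        ((Real.sin (s * Real.cos (2 * Real.pi * u)) : ℝ) : ℂ) * Complex.I := by
    rw [Complex.exp_mul_I]
    push_cast
    rfl
  simp_rw [h4]
  rw [intervalIntegral.integral_add (Continuous.intervalIntegrable (by fun_prop) _ _)
    (Continuous.intervalIntegrable (by fun_prop) _ _), intervalIntegral.integral_mul_const,
    intervalIntegral.integral_ofReal, intervalIntegral.integral_ofReal, hsin]
  simp [besselJ]

theorem integral_exp_latticeSymbol (d : ℕ) (t : ℝ) :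
    ∫ u, Complex.exp (t * latticeSymbol u * Complex.I) ∂(torusMeasure d) =
      ((besselJ (2 * t) ^ d : ℝ) : ℂ) := by
  have h (u : Fin d → ℝ) : Complex.exp (t * latticeSymbol u * Complex.I) =
      ∏ i, Complex.exp ((2 * t : ℝ) * Real.cos (2 * Real.pi * u i) * Complex.I) := by
    rw [← Complex.exp_sum, latticeSymbol]
    push_cast
    rw [Finset.mul_sum, Finset.sum_mul]
    congr 1
    refine Finset.sum_congr rfl fun i _ => ?_
    ring
  simp_rw [h]
  rw [integral_fintype_prod_eq_prod (𝕜 := ℂ)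
    (fun _ (v : ℝ) => Complex.exp ((2 * t : ℝ) * Real.cos (2 * Real.pi * v) * Complex.I))]
  simp_rw [integral_exp_mul_cos]
  simp

end Bessel

/-! ### Integrability of powers of the Bessel function -/

section BesselPower

theorem integrable_comp_abs {f : ℝ → ℝ} (hf : IntegrableOn f (Set.Ioi 0)) :
    Integrable fun x => f |x| := by
  have h1 : IntegrableOn (fun x => f |x|) (Set.Ioi 0) :=
    hf.congr_fun (fun x hx => by rw [abs_of_pos hx]) measurableSet_Ioi
  have h2 : IntegrableOn (fun x => f |x|) (Set.Iic 0) := by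
    rw [← Measure.map_neg_eq_self (volume : Measure ℝ)]
    have m : MeasurableEmbedding fun x : ℝ => -x := (Homeomorph.neg ℝ).measurableEmbedding
    rw [m.integrableOn_map_iff]
    simp_rw [Function.comp_def, abs_neg, Set.neg_preimage, Set.neg_Iic, neg_zero]
    exact Iff.mpr integrableOn_Ici_iff_integrableOn_Ioi h1
  rw [← integrableOn_univ, ← Set.Iic_union_Ioi (a := (0 : ℝ))]
  exact h2.union h1

theorem besselJ_abs (s : ℝ) : besselJ |s| = besselJ s := by
  rcases abs_choice s with h | h <;> rw [h]
  exact besselJ_neg s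

theorem abs_besselJ_pow_le_one (d : ℕ) (s : ℝ) : |besselJ s| ^ d ≤ 1 :=
  pow_le_one₀ (abs_nonneg _) (abs_besselJ_le_one s)

theorem abs_besselJ_pow_le (d : ℕ) {s : ℝ} (hs : 0 < s) :
    |besselJ s| ^ d ≤ s ^ (-((d : ℝ) / 2)) := by
  have h1 : |besselJ s| ≤ s ^ (-(1 / 2) : ℝ) := by
    rw [← Real.sqrt_sq_eq_abs, Real.rpow_neg hs.le, ← Real.inv_rpow hs.le, ← Real.sqrt_eq_rpow]
    exact Real.sqrt_le_sqrt (besselJ_sq_le hs)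
  refine (pow_le_pow_left₀ (abs_nonneg _) h1 d).trans (le_of_eq ?_)
  rw [← Real.rpow_natCast, ← Real.rpow_mul hs.le]
  ring_nf

/-- Near the origin the integrand is continuous, as `a ≥ 0`; at infinity it is at most a multiple of
`t^{a - d/2}`, with exponent below `-1`. -/
theorem integrableOn_rpow_mul_besselJ {d : ℕ} {a : ℝ} (ha : 0 ≤ a) (had : a < (d : ℝ) / 2 - 1) :
    IntegrableOn (fun t => t ^ a * |besselJ (2 * t)| ^ d) (Set.Ioi 0) := by
  have hc : Continuous fun t : ℝ => t ^ a * |besselJ (2 * t)| ^ d := by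
    have h1 := continuous_besselJ
    have h2 := Real.continuous_rpow_const ha
    fun_prop
  rw [← Set.Ioc_union_Ioi_eq_Ioi (zero_le_one (α := ℝ))]
  refine (hc.integrableOn_Ioc).union ?_
  have h1 : IntegrableOn (fun t : ℝ => 2 ^ (-((d : ℝ) / 2)) * t ^ (a - (d : ℝ) / 2))
      (Set.Ioi 1) :=
    (integrableOn_Ioi_rpow_of_lt (by linarith) one_pos).const_mul _
  refine Integrable.mono' h1 hc.aestronglyMeasurable ?_
  refine (ae_restrict_iff' measurableSet_Ioi).mpr (Eventually.of_forall fun t ht => ?_)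
  have ht0 : (0 : ℝ) < t := one_pos.trans ht
  have h2 := abs_besselJ_pow_le d (s := 2 * t) (by positivity)
  rw [Real.norm_of_nonneg (by positivity)]
  refine (mul_le_mul_of_nonneg_left h2 (by positivity)).trans (le_of_eq ?_)
  rw [Real.mul_rpow two_pos.le ht0.le, sub_eq_add_neg, Real.rpow_add ht0]
  ring

theorem integrableOn_abs_besselJ_pow {d : ℕ} (hd : 3 ≤ d) :
    IntegrableOn (fun t => |besselJ (2 * t)| ^ d) (Set.Ioi 0) := by
  have h3 : (3 : ℝ) ≤ d := by exact_mod_cast hd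
  simpa using integrableOn_rpow_mul_besselJ (d := d) le_rfl (by linarith)

theorem integrable_abs_besselJ_pow {d : ℕ} (hd : 3 ≤ d) :
    Integrable fun t : ℝ => |besselJ (2 * t)| ^ d := by
  refine (integrable_comp_abs (integrableOn_abs_besselJ_pow hd)).congr
    (Eventually.of_forall fun t => ?_)
  dsimp only
  rw [← abs_two, ← abs_mul, besselJ_abs, abs_two]

end BesselPower

/-! ### The density of states function of the Lloyd model -/

section LloydDensity

/-- The density of states function of the Lloyd model. -/
def lloydDensity (d : ℕ) (γ : ℝ≥0) (x : ℝ) : ℝ :=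
  (2 * Real.pi)⁻¹ * ∫ t : ℝ, Real.cos (x * t) * (Real.exp (-(γ * |t|)) * besselJ (2 * t) ^ d)

theorem integrable_exp_neg_abs {γ : ℝ≥0} (hγ : γ ≠ 0) :
    Integrable fun t : ℝ => Real.exp (-(γ * |t|)) := by
  have h := (integrable_exp_neg_abs_add (NNReal.coe_pos.mpr (pos_iff_ne_zero.mpr hγ)) 0).re
  refine h.congr (Eventually.of_forall fun t => ?_)
  have : (-(((γ : ℝ) : ℂ) * ((|t| : ℝ) : ℂ)) + ((0 : ℝ) : ℂ) * (t : ℂ) * Complex.I) =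
      ((-(γ * |t|) : ℝ) : ℂ) := by
    push_cast
    ring
  dsimp only
  rw [this, RCLike.re_eq_complex_re, Complex.exp_ofReal_re]

theorem cauchyPDFReal_eq_integral {γ : ℝ≥0} (hγ : γ ≠ 0) (x : ℝ) :
    cauchyPDFReal 0 γ x =
      (2 * Real.pi)⁻¹ * ∫ t : ℝ, Real.cos (x * t) * Real.exp (-(γ * |t|)) := by
  have hγ' : (0 : ℝ) < γ := NNReal.coe_pos.mpr (pos_iff_ne_zero.mpr hγ)
  have h1 := congrArg Complex.re (integral_exp_neg_abs_add hγ' x)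
  rw [← RCLike.re_eq_complex_re, ← integral_re (integrable_exp_neg_abs_add hγ' x),
    RCLike.re_eq_complex_re, Complex.ofReal_re] at h1
  have h2 (t : ℝ) : (Complex.exp (-(((γ : ℝ) : ℂ) * ((|t| : ℝ) : ℂ)) + (x : ℂ) * (t : ℂ) *
      Complex.I)).re = Real.cos (x * t) * Real.exp (-(γ * |t|)) := by
    have h3 : (-(((γ : ℝ) : ℂ) * ((|t| : ℝ) : ℂ)) + (x : ℂ) * (t : ℂ) * Complex.I) =
        ((-(γ * |t|) : ℝ) : ℂ) + ((x * t : ℝ) : ℂ) * Complex.I := by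
      push_cast
      ring
    rw [h3, Complex.exp_add, ← Complex.ofReal_exp, Complex.re_ofReal_mul,
      Complex.exp_ofReal_mul_I_re, mul_comm]
  simp_rw [h2] at h1
  rw [h1, cauchyPDFReal_def, sub_zero]
  have := Real.pi_pos
  field_simp
  ring

theorem integral_cos_sub_latticeSymbol (d : ℕ) (x t : ℝ) :
    ∫ u, Real.cos ((x - latticeSymbol u) * t) ∂(torusMeasure d) =
      Real.cos (x * t) * besselJ (2 * t) ^ d := by
  have hint : Integrable (fun u => Complex.exp ((-t : ℝ) * latticeSymbol u * Complex.I))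
      (torusMeasure d) := by
    refine Integrable.of_bound (C := 1) ?_ (Eventually.of_forall fun u => ?_)
    · exact (by fun_prop : Continuous fun u : Fin d → ℝ =>
        Complex.exp ((-t : ℝ) * latticeSymbol u * Complex.I)).aestronglyMeasurable
    · rw [← Complex.ofReal_mul, Complex.norm_exp_ofReal_mul_I]
  have h1 := congrArg (fun z => (Complex.exp ((x * t : ℝ) * Complex.I) * z).re)
    (integral_exp_latticeSymbol d (-t))
  rw [← integral_const_mul, ← RCLike.re_eq_complex_re, ← integral_re (hint.const_mul _)] at h1
  simp_rw [RCLike.re_eq_complex_re] at h1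
  rw [Complex.re_mul_ofReal, Complex.exp_ofReal_mul_I_re, mul_neg, besselJ_neg] at h1
  rw [← h1]
  refine integral_congr_ae (Eventually.of_forall fun u => ?_)
  have h2 : ((x * t : ℝ) : ℂ) * Complex.I + (-t : ℝ) * latticeSymbol u * Complex.I =
      (((x - latticeSymbol u) * t : ℝ) : ℂ) * Complex.I := by
    push_cast
    ring
  dsimp only
  rw [← Complex.exp_add, h2, Complex.exp_ofReal_mul_I_re]

/-- Fubini applied to the cosine representation of the Cauchy density. The domination comes from
`e^{-γ|t|}`, so `γ = 0` has to be reached by a limit. -/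
theorem lloydDensity_eq_integral_cauchyPDFReal {d : ℕ} {γ : ℝ≥0} (hγ : γ ≠ 0) (x : ℝ) :
    lloydDensity d γ x = ∫ u, cauchyPDFReal 0 γ (x - latticeSymbol u) ∂(torusMeasure d) := by
  simp_rw [cauchyPDFReal_eq_integral hγ]
  rw [integral_const_mul, lloydDensity, integral_integral_swap]
  · congr 1
    refine integral_congr_ae (Eventually.of_forall fun t => ?_)
    dsimp only
    rw [integral_mul_const, integral_cos_sub_latticeSymbol]
    ring
  · refine Integrable.mono' ((integrable_exp_neg_abs hγ).comp_snd (torusMeasure d)) ?_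
      (Eventually.of_forall fun q => ?_)
    · exact (by simp only [Function.uncurry_def]; fun_prop : Continuous (Function.uncurry
        fun (u : Fin d → ℝ) (t : ℝ) => Real.cos ((x - latticeSymbol u) * t) *
          Real.exp (-(γ * |t|)))).aestronglyMeasurable
    · simp only [Function.uncurry_def]
      rw [norm_mul, Real.norm_of_nonneg (Real.exp_pos _).le]
      exact mul_le_of_le_one_left (Real.exp_pos _).le (Real.abs_cos_le_one _)

theorem cauchyPDFReal_nonneg (γ : ℝ≥0) (x : ℝ) : 0 ≤ cauchyPDFReal 0 γ x := by
  rw [cauchyPDFReal_def]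
  positivity

theorem cauchyPDFReal_le (γ : ℝ≥0) (x : ℝ) :
    cauchyPDFReal 0 γ x ≤ Real.pi⁻¹ * γ * ((γ : ℝ) ^ 2)⁻¹ := by
  rcases eq_or_ne γ 0 with rfl | hγ
  · simp
  rw [cauchyPDFReal_def, sub_zero]
  have hγ' : (0 : ℝ) < γ := NNReal.coe_pos.mpr (pos_iff_ne_zero.mpr hγ)
  have := sq_nonneg x
  gcongr
  linarith

theorem lloydDOS_eq_withDensity_of_ne_zero {d : ℕ} {γ : ℝ≥0} (hγ : γ ≠ 0) :
    lloydDOS d γ = volume.withDensity fun x => ENNReal.ofReal (lloydDensity d γ x) := by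
  ext s hs
  have hm : Measurable fun q : (Fin d → ℝ) × ℝ => cauchyPDFReal 0 γ (q.2 - latticeSymbol q.1) :=
    (measurable_cauchyPDFReal 0 γ).comp (by fun_prop)
  rw [lloydDOS, Measure.map_apply (measurable_latticeSymbol_add d) hs,
    Measure.prod_apply (measurable_latticeSymbol_add d hs), withDensity_apply _ hs]
  have h1 (x : ℝ) : ENNReal.ofReal (lloydDensity d γ x) =
      ∫⁻ u, ENNReal.ofReal (cauchyPDFReal 0 γ (x - latticeSymbol u)) ∂(torusMeasure d) := by
    rw [lloydDensity_eq_integral_cauchyPDFReal hγ, ofReal_integral_eq_lintegral_ofReal]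
    · refine Integrable.of_bound (C := Real.pi⁻¹ * γ * ((γ : ℝ) ^ 2)⁻¹) ?_
        (Eventually.of_forall fun u => ?_)
      · exact ((measurable_cauchyPDFReal 0 γ).comp
          (by fun_prop : Measurable fun u : Fin d → ℝ => x - latticeSymbol u)).aestronglyMeasurable
      · rw [Real.norm_of_nonneg (cauchyPDFReal_nonneg γ _)]
        exact cauchyPDFReal_le γ _
    · exact Eventually.of_forall fun u => cauchyPDFReal_nonneg γ _
  simp_rw [h1]
  rw [lintegral_lintegral_swap]
  · refine lintegral_congr fun u => ?_
    have h2 : Prod.mk u ⁻¹' ((fun q : (Fin d → ℝ) × ℝ => latticeSymbol q.1 + q.2) ⁻¹' s) =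
        (fun y => latticeSymbol u + y) ⁻¹' s := rfl
    rw [h2, cauchyMeasure_of_scale_ne_zero 0 hγ,
      withDensity_apply _ ((measurable_const_add (latticeSymbol u)) hs),
      ← lintegral_indicator hs, ← lintegral_indicator ((measurable_const_add _) hs),
      ← lintegral_add_left_eq_self (s.indicator fun x =>
        ENNReal.ofReal (cauchyPDFReal 0 γ (x - latticeSymbol u))) (latticeSymbol u)]
    refine lintegral_congr fun y => ?_
    simp only [Set.indicator, Set.mem_preimage, add_sub_cancel_left]
    rfl
  · exact (hm.comp (measurable_snd.prodMk measurable_fst)).ennreal_ofReal.aemeasurable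

end LloydDensity

/-! ### Absolute continuity of the density of states measure -/

section LloydAbsolutelyContinuous

variable {d : ℕ}

theorem norm_lloydDensity_integrand_le (γ : ℝ≥0) (x t : ℝ) :
    ‖Real.cos (x * t) * (Real.exp (-(γ * |t|)) * besselJ (2 * t) ^ d)‖ ≤
      |besselJ (2 * t)| ^ d := by
  have h1 : Real.exp (-(γ * |t|)) ≤ 1 := Real.exp_le_one_iff.mpr (neg_nonpos.mpr (by positivity))
  rw [norm_mul, norm_mul, norm_pow, Real.norm_eq_abs, Real.norm_eq_abs, Real.norm_eq_abs,
    abs_of_pos (Real.exp_pos _)]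
  exact (mul_le_of_le_one_left (by positivity) (Real.abs_cos_le_one _)).trans
    (mul_le_of_le_one_left (by positivity) h1)

theorem continuous_lloydDensity_integrand (γ : ℝ≥0) :
    Continuous fun q : ℝ × ℝ =>
      Real.cos (q.1 * q.2) * (Real.exp (-(γ * |q.2|)) * besselJ (2 * q.2) ^ d) := by
  have := continuous_besselJ
  fun_prop

theorem integrable_lloydDensity_integrand (hd : 3 ≤ d) (γ : ℝ≥0) (x : ℝ) :
    Integrable fun t : ℝ =>
      Real.cos (x * t) * (Real.exp (-(γ * |t|)) * besselJ (2 * t) ^ d) :=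
  (integrable_abs_besselJ_pow hd).mono'
    ((continuous_lloydDensity_integrand γ).comp
      (Continuous.prodMk_right x)).aestronglyMeasurable
    (Eventually.of_forall fun t => norm_lloydDensity_integrand_le γ x t)

theorem continuous_lloydDensity (hd : 3 ≤ d) (γ : ℝ≥0) : Continuous (lloydDensity d γ) := by
  refine continuous_const.mul (continuous_of_dominated
    (bound := fun t => |besselJ (2 * t)| ^ d) (fun x => ?_) (fun x => ?_)
    (integrable_abs_besselJ_pow hd) (Eventually.of_forall fun t => ?_))
  · exact (integrable_lloydDensity_integrand hd γ x).aestronglyMeasurable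
  · exact Eventually.of_forall fun t => norm_lloydDensity_integrand_le γ x t
  · exact (continuous_lloydDensity_integrand γ).comp (Continuous.prodMk_left t)

theorem abs_lloydDensity_le (hd : 3 ≤ d) (γ : ℝ≥0) (x : ℝ) :
    |lloydDensity d γ x| ≤ (2 * Real.pi)⁻¹ * ∫ t : ℝ, |besselJ (2 * t)| ^ d := by
  have := Real.pi_pos
  rw [lloydDensity, abs_mul, abs_of_pos (by positivity)]
  gcongr
  exact norm_integral_le_of_norm_le (integrable_abs_besselJ_pow hd)
    (Eventually.of_forall fun t => norm_lloydDensity_integrand_le γ x t)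

theorem tendsto_lloydDensity (hd : 3 ≤ d) {γ : ℕ → ℝ≥0} (hγ : Tendsto γ atTop (𝓝 0)) (x : ℝ) :
    Tendsto (fun n => lloydDensity d (γ n) x) atTop (𝓝 (lloydDensity d 0 x)) := by
  refine (tendsto_integral_of_dominated_convergence (fun t => |besselJ (2 * t)| ^ d)
    (fun n => (integrable_lloydDensity_integrand hd (γ n) x).aestronglyMeasurable)
    (integrable_abs_besselJ_pow hd)
    (fun n => Eventually.of_forall fun t => norm_lloydDensity_integrand_le (γ n) x t)
    (Eventually.of_forall fun t => ?_)).const_mul _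
  have h1 : Continuous fun c : ℝ≥0 =>
      Real.cos (x * t) * (Real.exp (-(c * |t|)) * besselJ (2 * t) ^ d) := by fun_prop
  exact (h1.tendsto 0).comp hγ

theorem lloydDensity_nonneg (hd : 3 ≤ d) (γ : ℝ≥0) (x : ℝ) : 0 ≤ lloydDensity d γ x := by
  have h (γ : ℝ≥0) (hγ : γ ≠ 0) : 0 ≤ lloydDensity d γ x := by
    rw [lloydDensity_eq_integral_cauchyPDFReal hγ]
    exact integral_nonneg fun u => cauchyPDFReal_nonneg γ _
  rcases eq_or_ne γ 0 with rfl | hγ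
  · refine ge_of_tendsto' (tendsto_lloydDensity hd
      (tendsto_one_div_add_atTop_nhds_zero_nat (𝕜 := ℝ≥0)) x) fun n => h _ ?_
    positivity
  · exact h γ hγ

/-- Scaling puts all widths, including zero, on one probability space, so weak convergence as `γ →
0` reduces to dominated convergence. -/
theorem cauchyMeasure_eq_map (γ : ℝ≥0) :
    cauchyMeasure 0 γ = (cauchyMeasure 0 1).map fun y => (γ : ℝ) * y := by
  have : IsProbabilityMeasure ((cauchyMeasure 0 1).map fun y => (γ : ℝ) * y) :=
    Measure.isProbabilityMeasure_map (by fun_prop)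
  refine Measure.ext_of_charFun (funext fun t => ?_)
  rw [charFun_map_mul, charFun_cauchyMeasure, charFun_cauchyMeasure, abs_mul, NNReal.abs_eq]
  push_cast
  ring_nf

theorem integral_lloydDOS_of_bounded {f : ℝ → ℝ} (hf : Continuous f) {C : ℝ}
    (hC : ∀ x, |f x| ≤ C) (γ : ℝ≥0) :
    ∫ x, f x ∂(lloydDOS d γ) =
      ∫ u, ∫ y, f (latticeSymbol u + γ * y) ∂(cauchyMeasure 0 1) ∂(torusMeasure d) := by
  rw [integral_lloydDOS (Integrable.of_bound hf.aestronglyMeasurable C (Eventually.of_forall hC))]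
  refine integral_congr_ae (Eventually.of_forall fun u => ?_)
  dsimp only
  rw [cauchyMeasure_eq_map γ, integral_map (by fun_prop) (by fun_prop)]

theorem tendsto_integral_lloydDOS {f : ℝ → ℝ} (hf : Continuous f) {C : ℝ}
    (hC : ∀ x, |f x| ≤ C) {γ : ℕ → ℝ≥0} (hγ : Tendsto γ atTop (𝓝 0)) :
    Tendsto (fun n => ∫ x, f x ∂(lloydDOS d (γ n))) atTop (𝓝 (∫ x, f x ∂(lloydDOS d 0))) := by
  have hint (c : ℝ≥0) : Integrable (fun q : (Fin d → ℝ) × ℝ => f (latticeSymbol q.1 + c * q.2))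
      ((torusMeasure d).prod (cauchyMeasure 0 1)) :=
    Integrable.of_bound (hf.measurable.comp (by fun_prop)).aestronglyMeasurable C
      (Eventually.of_forall fun q => hC _)
  simp_rw [integral_lloydDOS_of_bounded hf hC]
  have h (c : ℝ≥0) : ∫ u, ∫ y, f (latticeSymbol u + c * y) ∂(cauchyMeasure 0 1) ∂(torusMeasure d) =
      ∫ q, f (latticeSymbol q.1 + c * q.2) ∂((torusMeasure d).prod (cauchyMeasure 0 1)) :=
    (integral_prod _ (hint c)).symm
  simp_rw [h]
  refine tendsto_integral_of_dominated_convergence (fun _ => C)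
    (fun n => (hint (γ n)).aestronglyMeasurable) (integrable_const _)
    (fun n => Eventually.of_forall fun q => hC _) (Eventually.of_forall fun q => ?_)
  have h1 : Continuous fun c : ℝ≥0 => f (latticeSymbol q.1 + c * q.2) := by fun_prop
  exact (h1.tendsto 0).comp hγ

theorem integral_withDensity_lloydDensity (hd : 3 ≤ d) (γ : ℝ≥0) (f : ℝ → ℝ) :
    ∫ x, f x ∂(volume.withDensity fun x => ENNReal.ofReal (lloydDensity d γ x)) =
      ∫ x, lloydDensity d γ x * f x := by
  rw [integral_withDensity_eq_integral_toReal_smul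
    (continuous_lloydDensity hd γ).measurable.ennreal_ofReal
    (Eventually.of_forall fun x => ENNReal.ofReal_lt_top)]
  refine integral_congr_ae (Eventually.of_forall fun x => ?_)
  dsimp only
  rw [ENNReal.toReal_ofReal (lloydDensity_nonneg hd γ x), smul_eq_mul]

theorem lloydDOS_eq_withDensity (hd : 3 ≤ d) (γ : ℝ≥0) :
    lloydDOS d γ = volume.withDensity fun x => ENNReal.ofReal (lloydDensity d γ x) := by
  rcases eq_or_ne γ 0 with rfl | hγ
  -- Without Cauchy smoothing the identity is obtained along `γ = 1/(n+1)`: against a compactly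
  -- supported test function both the measures and the densities converge, the latter with a bound
  -- uniform in `γ`.
  · have : IsLocallyFiniteMeasure
        (volume.withDensity fun x => ENNReal.ofReal (lloydDensity d 0 x)) :=
      IsLocallyFiniteMeasure.withDensity_ofReal (continuous_lloydDensity hd 0)
    refine Measure.ext_of_integral_eq_on_compactlySupported fun f => ?_
    have hγ : Tendsto (fun n : ℕ => (1 / ((n : ℝ≥0) + 1))) atTop (𝓝 0) :=
      tendsto_one_div_add_atTop_nhds_zero_nat
    obtain ⟨C, hC⟩ := f.hasCompactSupport.exists_bound_of_continuous f.continuous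
    have h1 := tendsto_integral_lloydDOS (d := d) f.continuous hC hγ
    have h2 (n : ℕ) : ∫ x, f x ∂(lloydDOS d (1 / ((n : ℝ≥0) + 1))) =
        ∫ x, lloydDensity d (1 / ((n : ℝ≥0) + 1)) x * f x := by
      rw [lloydDOS_eq_withDensity_of_ne_zero (by positivity), integral_withDensity_lloydDensity hd]
    replace h1 := h1.congr h2
    rw [integral_withDensity_lloydDensity hd]
    have hf : Integrable f := f.continuous.integrable_of_hasCompactSupport f.hasCompactSupport
    refine tendsto_nhds_unique h1 (tendsto_integral_of_dominated_convergence
      (fun x => ((2 * Real.pi)⁻¹ * ∫ t : ℝ, |besselJ (2 * t)| ^ d) * ‖f x‖)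
      (fun n => ((continuous_lloydDensity hd _).mul f.continuous).aestronglyMeasurable)
      (hf.norm.const_mul _) (fun n => Eventually.of_forall fun x => ?_)
      (Eventually.of_forall fun x => (tendsto_lloydDensity hd hγ x).mul_const _))
    rw [norm_mul]
    gcongr
    exact abs_lloydDensity_le hd _ x
  · exact lloydDOS_eq_withDensity_of_ne_zero hγ

theorem isDOSFunction_lloydDensity (hd : 3 ≤ d) (γ : ℝ≥0) :
    IsDOSFunction d (lloydLaw γ) (lloydDensity d γ) := by
  refine ⟨(continuous_lloydDensity hd γ).measurable, lloydDensity_nonneg hd γ, ?_⟩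
  rw [← lloydDOS_eq_withDensity hd]
  exact isDOSMeasure_lloydDOS d γ

theorem IsDOSFunction.ae_eq_lloydDensity (hd : 3 ≤ d) {γ : ℝ≥0} {ρ : ℝ → ℝ}
    (hρ : IsDOSFunction d (lloydLaw γ) ρ) : ρ =ᵐ[volume] lloydDensity d γ := by
  have h := isDOSFunction_lloydDensity hd γ
  have h1 := IsDOSMeasure.unique hρ.2.2 h.2.2
  rw [withDensity_eq_iff_of_sigmaFinite hρ.1.ennreal_ofReal.aemeasurable
    h.1.ennreal_ofReal.aemeasurable] at h1
  filter_upwards [h1] with x hx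
  exact (ENNReal.ofReal_eq_ofReal_iff (hρ.2.1 x) (h.2.1 x)).mp hx

end LloydAbsolutelyContinuous

/-! ### The dependence of the density of states function on the disorder -/

section LloydEstimate

variable {d : ℕ}

/-- The weighted tail integral that controls the dependence of the density of states function on
the disorder. -/
def lloydDefect (d : ℕ) (γ : ℝ≥0) : ℝ :=
  ∫ t in Set.Ioi (0 : ℝ), (1 - Real.exp (-(γ * t))) * |besselJ (2 * t)| ^ d

theorem one_sub_exp_neg_mem {x : ℝ} (hx : 0 ≤ x) :
    0 ≤ 1 - Real.exp (-x) ∧ 1 - Real.exp (-x) ≤ 1 ∧ 1 - Real.exp (-x) ≤ x := by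
  have h1 := Real.exp_pos (-x)
  have h2 := Real.add_one_le_exp (-x)
  have h3 : Real.exp (-x) ≤ 1 := Real.exp_le_one_iff.mpr (by linarith)
  exact ⟨by linarith, by linarith, by linarith⟩

/-- The left side is at most `min 1 x`, which is at most `x^a` for every `a` in `[0, 1]`. -/
theorem one_sub_exp_neg_le_rpow {x a : ℝ} (hx : 0 < x) (ha : 0 ≤ a) (ha1 : a ≤ 1) :
    1 - Real.exp (-x) ≤ x ^ a := by
  obtain ⟨-, h1, h2⟩ := one_sub_exp_neg_mem hx.le
  rcases le_total x 1 with h | h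
  · refine h2.trans ?_
    simpa using Real.rpow_le_rpow_of_exponent_ge hx h ha1
  · exact h1.trans (Real.one_le_rpow h ha)

theorem integrableOn_lloydDefect (hd : 3 ≤ d) (γ : ℝ≥0) :
    IntegrableOn (fun t => (1 - Real.exp (-(γ * t))) * |besselJ (2 * t)| ^ d) (Set.Ioi 0) := by
  have hc : Continuous fun t : ℝ => (1 - Real.exp (-(γ * t))) * |besselJ (2 * t)| ^ d := by
    have := continuous_besselJ
    fun_prop
  refine Integrable.mono' (integrableOn_abs_besselJ_pow hd) hc.aestronglyMeasurable
    ((ae_restrict_iff' measurableSet_Ioi).mpr (Eventually.of_forall fun t ht => ?_))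
  have ht' : (0 : ℝ) ≤ γ * t := mul_nonneg γ.coe_nonneg (le_of_lt ht)
  obtain ⟨h0, h1, -⟩ := one_sub_exp_neg_mem ht'
  rw [Real.norm_of_nonneg (by positivity)]
  exact mul_le_of_le_one_left (by positivity) h1

/-- The two Fourier integrals differ only in the factor `e^{-γ|t|}`; the cosine is bounded by one,
and evenness in `t` turns `1/(2π)` into `1/π`. -/
theorem abs_lloydDensity_sub_le (hd : 3 ≤ d) (γ : ℝ≥0) (x : ℝ) :
    |lloydDensity d γ x - lloydDensity d 0 x| ≤ Real.pi⁻¹ * lloydDefect d γ := by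
  have hpi := Real.pi_pos
  have h1 := integrable_comp_abs (integrableOn_lloydDefect hd γ)
  have h2 : ∫ t : ℝ, (1 - Real.exp (-(γ * |t|))) * |besselJ (2 * |t|)| ^ d =
      2 * lloydDefect d γ :=
    integral_comp_abs (f := fun t => (1 - Real.exp (-(γ * t))) * |besselJ (2 * t)| ^ d)
  rw [lloydDensity, lloydDensity, ← mul_sub,
    ← integral_sub (integrable_lloydDensity_integrand hd γ x)
      (integrable_lloydDensity_integrand hd 0 x), abs_mul, abs_of_pos (by positivity)]
  have h3 : Real.pi⁻¹ * lloydDefect d γ = (2 * Real.pi)⁻¹ * (2 * lloydDefect d γ) := by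
    field_simp
  rw [h3, ← h2]
  refine mul_le_mul_of_nonneg_left ?_ (by positivity)
  rw [← Real.norm_eq_abs]
  refine norm_integral_le_of_norm_le h1 (Eventually.of_forall fun t => ?_)
  have h4 : Real.cos (x * t) * (Real.exp (-(γ * |t|)) * besselJ (2 * t) ^ d) -
      Real.cos (x * t) * (Real.exp (-((0 : ℝ≥0) * |t|)) * besselJ (2 * t) ^ d) =
      -(Real.cos (x * t) * ((1 - Real.exp (-(γ * |t|))) * besselJ (2 * t) ^ d)) := by
    rw [NNReal.coe_zero, zero_mul, neg_zero, Real.exp_zero]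
    ring
  have h5 : besselJ (2 * |t|) = besselJ (2 * t) := by
    rw [← besselJ_abs (2 * t), abs_mul, abs_two]
  obtain ⟨h0, -, -⟩ := one_sub_exp_neg_mem (x := γ * |t|) (by positivity)
  rw [h4, h5, norm_neg, norm_mul, norm_mul, norm_pow, Real.norm_eq_abs, Real.norm_eq_abs,
    Real.norm_eq_abs, abs_of_nonneg h0]
  exact mul_le_of_le_one_left (by positivity) (Real.abs_cos_le_one _)

theorem lloydDefect_le_rpow (hd : 3 ≤ d) {a : ℝ} (ha : 0 ≤ a) (ha1 : a ≤ 1)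
    (had : a < (d : ℝ) / 2 - 1) {γ : ℝ≥0} (hγ : 0 < γ) :
    lloydDefect d γ ≤ (γ : ℝ) ^ a * ∫ t in Set.Ioi (0 : ℝ), t ^ a * |besselJ (2 * t)| ^ d := by
  have hγ' : (0 : ℝ) < γ := hγ
  rw [← integral_const_mul]
  refine setIntegral_mono_on (integrableOn_lloydDefect hd γ)
    ((integrableOn_rpow_mul_besselJ ha had).const_mul _) measurableSet_Ioi fun t ht => ?_
  have ht0 : (0 : ℝ) < t := ht
  rw [← mul_assoc, ← Real.mul_rpow hγ'.le ht0.le]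
  gcongr
  exact one_sub_exp_neg_le_rpow (by positivity) ha ha1

/-- Below `T` use `1 - e^{-γt} ≤ γt` and `|J₀| ≤ 1`; above `T` use `1 - e^{-γt} ≤ 1` and the decay
of `J₀`. -/
theorem lloydDefect_le_add (hd : 3 ≤ d) (γ : ℝ≥0) {T : ℝ} (hT : 0 < T) :
    lloydDefect d γ ≤ γ * (T ^ 2 / 2) +
      2 ^ (-((d : ℝ) / 2)) * (T ^ (1 - (d : ℝ) / 2) / ((d : ℝ) / 2 - 1)) := by
  have h3 : (3 : ℝ) ≤ d := by exact_mod_cast hd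
  have hint := integrableOn_lloydDefect hd γ
  rw [lloydDefect, ← Set.Ioc_union_Ioi_eq_Ioi hT.le, setIntegral_union Set.Ioc_disjoint_Ioi_same
    measurableSet_Ioi (hint.mono_set Set.Ioc_subset_Ioi_self)
    (hint.mono_set (Set.Ioi_subset_Ioi hT.le))]
  refine add_le_add ?_ ?_
  · have h4 : ∫ t in Set.Ioc 0 T, (γ : ℝ) * t = γ * (T ^ 2 / 2) := by
      rw [integral_const_mul, ← intervalIntegral.integral_of_le hT.le, integral_id]
      ring
    rw [← h4]
    refine setIntegral_mono_on (hint.mono_set Set.Ioc_subset_Ioi_self)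
      ((by fun_prop : Continuous fun t : ℝ => (γ : ℝ) * t).integrableOn_Ioc)
      measurableSet_Ioc fun t ht => ?_
    have ht0 : (0 : ℝ) ≤ γ * t := mul_nonneg γ.coe_nonneg ht.1.le
    obtain ⟨h0, -, h1⟩ := one_sub_exp_neg_mem ht0
    exact (mul_le_of_le_one_right h0 (abs_besselJ_pow_le_one d _)).trans h1
  · have h4 : ∫ t in Set.Ioi T, (2 : ℝ) ^ (-((d : ℝ) / 2)) * t ^ (-((d : ℝ) / 2)) =
        2 ^ (-((d : ℝ) / 2)) * (T ^ (1 - (d : ℝ) / 2) / ((d : ℝ) / 2 - 1)) := by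
      rw [integral_const_mul, integral_Ioi_rpow_of_lt (by linarith) hT,
        show -((d : ℝ) / 2) + 1 = -((d : ℝ) / 2 - 1) by ring, neg_div_neg_eq, neg_sub]
    rw [← h4]
    refine setIntegral_mono_on (hint.mono_set (Set.Ioi_subset_Ioi hT.le))
      ((integrableOn_Ioi_rpow_of_lt (by linarith) hT).const_mul _) measurableSet_Ioi
      fun t ht => ?_
    have ht0 : (0 : ℝ) < t := hT.trans ht
    obtain ⟨-, h1, -⟩ := one_sub_exp_neg_mem (x := γ * t) (by positivity)
    rw [← Real.mul_rpow two_pos.le ht0.le]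
    exact (mul_le_of_le_one_left (by positivity) h1).trans
      (abs_besselJ_pow_le d (by positivity))

theorem lloydDefect_le_lloydConst (hd : 3 ≤ d) {γ : ℝ≥0} (hγ : 0 < γ) :
    Real.pi⁻¹ * lloydDefect d γ ≤
      lloydConst d * (γ : ℝ) ^ (((d : ℝ) - 2) / ((d : ℝ) + 2)) := by
  have hpi := Real.pi_pos
  have hγ' : (0 : ℝ) < γ := hγ
  have h3 : (3 : ℝ) ≤ d := by exact_mod_cast hd
  -- This `T` balances the two terms: `γT² = T^{1 - d/2} = γ^{(d-2)/(d+2)}`.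
  have h1 := lloydDefect_le_add hd γ (T := (γ : ℝ) ^ (-2 / ((d : ℝ) + 2))) (by positivity)
  have h2 : (γ : ℝ) * (((γ : ℝ) ^ (-2 / ((d : ℝ) + 2))) ^ 2 / 2) =
      (γ : ℝ) ^ (((d : ℝ) - 2) / ((d : ℝ) + 2)) / 2 := by
    have : ((d : ℝ) - 2) / ((d : ℝ) + 2) = 1 + -2 / ((d : ℝ) + 2) * (2 : ℕ) := by
      field_simp
      push_cast
      ring
    rw [← Real.rpow_mul_natCast hγ'.le, this, Real.rpow_add hγ', Real.rpow_one]
    ring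
  have h4 : ((γ : ℝ) ^ (-2 / ((d : ℝ) + 2))) ^ (1 - (d : ℝ) / 2) =
      (γ : ℝ) ^ (((d : ℝ) - 2) / ((d : ℝ) + 2)) := by
    rw [← Real.rpow_mul hγ'.le]
    congr 1
    field_simp
    ring
  rw [h2, h4] at h1
  have h5 : (2 : ℝ) ^ (-((d : ℝ) / 2)) * 4 = 2 ^ (2 - (d : ℝ) / 2) := by
    rw [sub_eq_add_neg, Real.rpow_add two_pos]
    norm_num [mul_comm]
  set P := (γ : ℝ) ^ (((d : ℝ) - 2) / ((d : ℝ) + 2)) with hP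
  have hP0 : 0 < P := by positivity
  -- The argument yields `1` in place of `e` and half of the second term, so the stated constant has
  -- room to spare.
  have h6 : Real.pi⁻¹ * lloydDefect d γ ≤ (1 / (2 * Real.pi) +
      2 ^ (-((d : ℝ) / 2)) * 2 / (Real.pi * ((d : ℝ) - 2))) * P := by
    refine (mul_le_mul_of_nonneg_left h1 (by positivity)).trans (le_of_eq ?_)
    have : (d : ℝ) - 2 ≠ 0 := by linarith
    have h7 : (d : ℝ) / 2 - 1 = ((d : ℝ) - 2) / 2 := by ring
    rw [h7]
    field_simp
  refine h6.trans (mul_le_mul_of_nonneg_right ?_ hP0.le)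
  have h8 : (0 : ℝ) < (d : ℝ) - 2 := by linarith
  rw [lloydConst, ← h5]
  gcongr
  · exact Real.one_le_exp zero_le_one
  · norm_num

theorem lloydConstWeak_pos (hd : 3 ≤ d) : 0 < lloydConstWeak d := by
  have h3 : (3 : ℝ) ≤ d := by exact_mod_cast hd
  have h8 : (0 : ℝ) < (d : ℝ) - 2 := by linarith
  have hpi := Real.pi_pos
  rw [lloydConstWeak]
  positivity

theorem exists_lloydDefect_le_lloydConstWeak (hd : 3 ≤ d) :
    ∃ γ₁ : ℝ≥0, 0 < γ₁ ∧ ∀ γ : ℝ≥0, 0 < γ → γ ≤ γ₁ → Real.pi⁻¹ * lloydDefect d γ ≤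
      lloydConstWeak d * (γ : ℝ) ^ (((d : ℝ) - 2) / ((d : ℝ) + 2)) := by
  have h3 : (3 : ℝ) ≤ d := by exact_mod_cast hd
  have h8 : (0 : ℝ) < (d : ℝ) - 2 := by linarith
  have hpi := Real.pi_pos
  -- Any exponent with `b < a ≤ 1` and `a < d/2 - 1` would do. The surplus factor `γ^{a - b}` tends
  -- to zero, so only the positivity of `lloydConstWeak d` matters.
  set a : ℝ := ((d : ℝ) - 2) / ((d : ℝ) + 1) with ha
  set b : ℝ := ((d : ℝ) - 2) / ((d : ℝ) + 2) with hb
  have hab : 0 < a - b := sub_pos.mpr (div_lt_div_of_pos_left h8 (by linarith) (by linarith))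
  have ha0 : 0 ≤ a := by positivity
  have ha1 : a ≤ 1 := (div_le_one (by linarith)).mpr (by linarith)
  have had : a < (d : ℝ) / 2 - 1 := by
    rw [show (d : ℝ) / 2 - 1 = ((d : ℝ) - 2) / 2 by ring]
    exact div_lt_div_of_pos_left h8 two_pos (by linarith)
  set C := ∫ t in Set.Ioi (0 : ℝ), t ^ a * |besselJ (2 * t)| ^ d
  have hlim : Tendsto (fun γ : ℝ≥0 => Real.pi⁻¹ * C * (γ : ℝ) ^ (a - b)) (𝓝 0) (𝓝 0) := by
    have hc : Continuous fun γ : ℝ≥0 => Real.pi⁻¹ * C * (γ : ℝ) ^ (a - b) :=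
      continuous_const.mul ((Real.continuous_rpow_const hab.le).comp NNReal.continuous_coe)
    simpa [Real.zero_rpow hab.ne'] using hc.tendsto 0
  obtain ⟨ε, hε, hball⟩ := Metric.eventually_nhds_iff.mp
    (hlim.eventually_le_const (lloydConstWeak_pos hd))
  refine ⟨⟨ε / 2, by positivity⟩, half_pos hε, fun γ hγ hle => ?_⟩
  have hγ' : (0 : ℝ) < γ := hγ
  have h4 : Real.pi⁻¹ * C * (γ : ℝ) ^ (a - b) ≤ lloydConstWeak d := by
    refine hball ?_
    rw [NNReal.dist_eq, NNReal.coe_zero, sub_zero, abs_of_pos hγ']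
    exact lt_of_le_of_lt (show (γ : ℝ) ≤ ε / 2 from hle) (half_lt_self hε)
  calc Real.pi⁻¹ * lloydDefect d γ ≤ Real.pi⁻¹ * ((γ : ℝ) ^ a * C) :=
        mul_le_mul_of_nonneg_left (lloydDefect_le_rpow hd ha0 ha1 had hγ) (by positivity)
    _ = Real.pi⁻¹ * C * (γ : ℝ) ^ (a - b) * (γ : ℝ) ^ b := by
        rw [mul_assoc _ _ ((γ : ℝ) ^ b), ← Real.rpow_add hγ', sub_add_cancel]
        ring
    _ ≤ _ := mul_le_mul_of_nonneg_right h4 (by positivity)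

theorem eLpNorm_sub_le_ofReal (hd : 3 ≤ d) {ρ : ℝ≥0 → ℝ → ℝ}
    (hρ : ∀ lam : ℝ≥0, IsDOSFunction d (lloydLaw lam) (ρ lam)) {γ : ℝ≥0} {C : ℝ}
    (hC : Real.pi⁻¹ * lloydDefect d γ ≤ C) :
    eLpNorm (fun E : ℝ => ρ γ E - ρ 0 E) ⊤ volume ≤ ENNReal.ofReal C := by
  rw [eLpNorm_exponent_top]
  refine eLpNormEssSup_le_of_ae_bound ?_
  filter_upwards [(hρ γ).ae_eq_lloydDensity hd, (hρ 0).ae_eq_lloydDensity hd] with x hx hx0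
  rw [hx, hx0]
  exact (abs_lloydDensity_sub_le hd γ x).trans hC

end LloydEstimate

end

theorem mainTheorem12 (d : ℕ) (hd : 3 ≤ d) :
    (∀ ω : LatticeSite d → ℝ, IsSelfAdjoint (anderson ω)) ∧
    (∀ lam : ℝ≥0, ∃! n : Measure ℝ, IsDOSMeasure d (lloydLaw lam) n) ∧
    (∀ lam : ℝ≥0, ∃ ρ : ℝ → ℝ, IsDOSFunction d (lloydLaw lam) ρ) ∧
    ∀ ρ : ℝ≥0 → ℝ → ℝ, (∀ lam : ℝ≥0, IsDOSFunction d (lloydLaw lam) (ρ lam)) →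
      Tendsto (fun lam : ℝ≥0 => eLpNorm (fun E : ℝ => ρ lam E - ρ 0 E) ⊤ volume)
        (𝓝[>] 0) (𝓝 0) ∧
      (∀ lam : ℝ≥0, 0 < lam →
        eLpNorm (fun E : ℝ => ρ lam E - ρ 0 E) ⊤ volume ≤
          ENNReal.ofReal (lloydConst d * (lam : ℝ) ^ (((d : ℝ) - 2) / ((d : ℝ) + 2)))) ∧
      ∃ lam₁ : ℝ≥0, 0 < lam₁ ∧ ∀ lam : ℝ≥0, 0 < lam → lam ≤ lam₁ →
        eLpNorm (fun E : ℝ => ρ lam E - ρ 0 E) ⊤ volume ≤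
          ENNReal.ofReal (lloydConstWeak d * (lam : ℝ) ^ (((d : ℝ) - 2) / ((d : ℝ) + 2))) := by
  refine ⟨isSelfAdjoint_anderson, fun lam => ⟨lloydDOS d lam, isDOSMeasure_lloydDOS d lam,
    fun n hn => hn.unique (isDOSMeasure_lloydDOS d lam)⟩,
    fun lam => ⟨lloydDensity d lam, isDOSFunction_lloydDensity hd lam⟩, fun ρ hρ => ?_⟩
  have hbound (lam : ℝ≥0) (hlam : 0 < lam) :
      eLpNorm (fun E : ℝ => ρ lam E - ρ 0 E) ⊤ volume ≤
        ENNReal.ofReal (lloydConst d * (lam : ℝ) ^ (((d : ℝ) - 2) / ((d : ℝ) + 2))) :=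
    eLpNorm_sub_le_ofReal hd hρ (lloydDefect_le_lloydConst hd hlam)
  refine ⟨?_, hbound, ?_⟩
  -- The exponent is positive, so the bound for all widths is continuous in the width and vanishes
  -- at zero; squeezing gives the convergence.
  · have h3 : (3 : ℝ) ≤ d := by exact_mod_cast hd
    have hb : 0 < ((d : ℝ) - 2) / ((d : ℝ) + 2) := div_pos (by linarith) (by linarith)
    have hc : Continuous fun lam : ℝ≥0 =>
        ENNReal.ofReal (lloydConst d * (lam : ℝ) ^ (((d : ℝ) - 2) / ((d : ℝ) + 2))) :=
      ENNReal.continuous_ofReal.comp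
        (continuous_const.mul ((Real.continuous_rpow_const hb.le).comp NNReal.continuous_coe))
    have hlim := hc.tendsto 0
    simp only [NNReal.coe_zero, Real.zero_rpow hb.ne', mul_zero, ENNReal.ofReal_zero] at hlim
    exact tendsto_of_tendsto_of_tendsto_of_le_of_le' tendsto_const_nhds
      (hlim.mono_left nhdsWithin_le_nhds) (Eventually.of_forall fun _ => zero_le)
      (eventually_nhdsWithin_of_forall fun lam hlam => hbound lam hlam)
  · obtain ⟨lam₁, h1, h2⟩ := exists_lloydDefect_le_lloydConstWeak hd
    exact ⟨lam₁, h1, fun lam hlam hle => eLpNorm_sub_le_ofReal hd hρ (h2 lam hlam hle)⟩
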